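/- Let $n\ge 1$. By a convex body in $\mathbb{R}^n$ we mean a compact convex set with non-empty interior; it is called centrally symmetric if $K=-K$. For sets $K,T\subseteq\mathbb{R}^n$, a weighted covering of $K$ by $T$ is a finite sequence $(x_i,\omega_i)_{i=1}^N$ of points $x_i\in\mathbb{R}^n$ and weights $\omega_i\ge 0$ such that $\sum_{i=1}^N\omega_i\mathbb{1}_{x_i+T}(x)\ge 1$ for every $x\in K$. The weighted covering number $N_\omega(K,T)$ is the infimum of the total weight $\sum_{i=1}^N\omega_i$ over all weighted coverings of $K$ by $T$. A direction $u\in\mathbb{S}^{n-1}$ illuminates a point $b\in\partial K$ if the ray emanating from $b$ in direction $u$ meets the interior of $K$. The fractional illumination number $i^*(K)$ is the infimum of $\sum_{i=1}^N\omega_i$ over all finite sequences $(u_i,\omega_i)_{i=1}^N$ of directions $u_i\in\mathbb{S}^{n-1}$ and weights $\omega_i\ge0$ such that, for every $b\in\partial K$, the sum of $\omega_i$ over those $i$ for which $u_i$ illuminates $b$ is at least $1$. A parallelotope is a set of the form $c+\{\sum_{i=1}^n t_ib_i : 0\le t_i\le 1\}$ with $c\in\mathbb{R}^n$ and $b_1,\dots,b_n$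 a basis of $\mathbb{R}^n$. **Theorem.** Let $K\subseteq\mathbb{R}^n$ be a convex body. Then the limit $\lim_{\lambda\to1^-}N_\omega(K,\lambda K)$ exists and $$\lim_{\lambda\to1^-}N_\omega(K,\lambda K)\le\begin{cases}2^n & \text{if } K=-K,\\ \binom{2n}{n} & \text{if } K\ne-K.\end{cases}$$ Moreover, if $K$ is centrally symmetric, then $\lim_{\lambda\to1^-}N_\omega(K,\lambda K)=2^n$ if and only if $K$ is a parallelotope. Furthermore, if $K$ is centrally symmetric, then $i^*(K)\le 2^n$, with equality if and only if $K$ is a parallelotope. -/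

import Mathlib

open scoped Pointwise NNReal ENNReal Topology

noncomputable section

/-- The finite sequence of pairs `(x i, w i)` of points and weights is a weighted covering of `K`
by `T`: every `y ∈ K` satisfies `∑ i, w i * 𝟙_{x i + T}(y) ≥ 1`. -/
def IsWeightedCovering {n N : ℕ} (K T : Set (EuclideanSpace ℝ (Fin n)))
    (x : Fin N → EuclideanSpace ℝ (Fin n)) (w : Fin N → ℝ≥0) : Prop :=
  ∀ y ∈ K, 1 ≤ ∑ i, w i * (x i +ᵥ T).indicator 1 y

/-- The weighted covering number `N_ω(K, T)`: the infimal total weight of all weighted coverings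
of `K` by `T`, with value `∞` if there is none. -/
def weightedCoveringNumber {n : ℕ} (K T : Set (EuclideanSpace ℝ (Fin n))) : ℝ≥0∞ :=
  ⨅ (N : ℕ) (x : Fin N → EuclideanSpace ℝ (Fin n)) (w : Fin N → ℝ≥0)
    (_ : IsWeightedCovering K T x w), ((∑ i, w i : ℝ≥0) : ℝ≥0∞)

/-- A parallelotope in `ℝⁿ`: a translate of `{∑ i, t i • b i | 0 ≤ t i ≤ 1}` for some basis `b`. -/
def IsParallelotope {n : ℕ} (K : Set (EuclideanSpace ℝ (Fin n))) : Prop :=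
  ∃ (b : Module.Basis (Fin n) ℝ (EuclideanSpace ℝ (Fin n))) (c : EuclideanSpace ℝ (Fin n)),
    K = c +ᵥ parallelepiped b

/-- The set of boundary points of `K` illuminated by the direction `u`: those `b ∈ ∂K` for which
the ray emanating from `b` in direction `u` meets the interior of `K`. -/
def illuminatedBy {n : ℕ} (K : Set (EuclideanSpace ℝ (Fin n)))
    (u : Metric.sphere (0 : EuclideanSpace ℝ (Fin n)) 1) : Set (EuclideanSpace ℝ (Fin n)) :=
  {b ∈ frontier K | ∃ t : ℝ, 0 ≤ t ∧ b + t • (u : EuclideanSpace ℝ (Fin n)) ∈ interior K}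

/-- Finitely many directions `u i` with weights `w i` form a fractional illumination of `K`: every
boundary point is illuminated by directions of total weight at least `1`. -/
def IsFractionalIllumination {n N : ℕ} (K : Set (EuclideanSpace ℝ (Fin n)))
    (u : Fin N → Metric.sphere (0 : EuclideanSpace ℝ (Fin n)) 1) (w : Fin N → ℝ≥0) : Prop :=
  ∀ b ∈ frontier K, 1 ≤ ∑ i, w i * (illuminatedBy K (u i)).indicator 1 b

/-- The fractional illumination number `i*(K)`: the infimal total weight of all fractional
illuminations of `K`. -/
def fractionalIlluminationNumber {n : ℕ} (K : Set (EuclideanSpace ℝ (Fin n))) : ℝ≥0∞ :=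
  ⨅ (N : ℕ) (u : Fin N → Metric.sphere (0 : EuclideanSpace ℝ (Fin n)) 1) (w : Fin N → ℝ≥0)
    (_ : IsFractionalIllumination K u w), ((∑ i, w i : ℝ≥0) : ℝ≥0∞)

end

/-! Since `K` is convex, `N_ω(K, rK)` decreases in `r`, so the limit is the infimum over `0 < r <
1`. Lebesgue measure on `K - rK`, divided by `vol(rK)`, covers every point of `K` exactly once.
Rounding it to a finite net costs only a slightly larger `r`, so the limit is at most `vol(K - K) /
vol K`. This is `2^n` when `K = -K`, because then `K - K = 2K`, and at most `binom(2n, n)` by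
Rogers–Shephard. A covering by translates `x i + rK` illuminates `K` in the directions `-x i`, so
`i*(K)` is at most the limit. For a parallelotope, no translate of `rK` and no direction serves two
of the `2^n` vertices, so both numbers equal `2^n`.

Conversely, let `K = -K` and let the limit be `2^n`. Hahn–Banach gives a dual optimum: a positive
functional `Λ` of mass `2^n` giving mass at most 1 to each smaller copy of `K`
(`exists_dual_functional`). Uniform measure on `2K` is asymptotically optimal for the primal
problem, so complementary slackness (`IsDualWeight.volume_le`) forces mass at least 1 near every
extreme point. Hence no two extreme points fit in one smaller copy, all other points have
neighbourhoods without mass, and there are exactly `2^n` extreme points `v`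
(`exists_finset_extremePoints`). The translates `v + K` then tile `2K` up to a null set.

This tiling makes `K` self-similar near a facet. Halving the height of a thin cap multiplies its
volume by at most `c / 2^n`, where `c` counts the vertices on the facet, while the volume is at
least linear in the height. So each facet carries at least half of the vertices
(`two_pow_le_two_mul_card_active`), and with its opposite all of them. Thus `n` independent facet
normals take only the values `±1` on the `2^n` vertices, and `K` is a linear image of a cube. -/

open scoped Pointwise NNReal ENNReal Topology
open MeasureTheory

/-! ### Covering numbers: monotonicity, the volume bound, illumination -/

section Covering

variable {n : ℕ} {K T T' : Set (EuclideanSpace ℝ (Fin n))}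

theorem isCompact_sub (hK : IsCompact K) (hT : IsCompact T) : IsCompact (K - T) := by
  rw [sub_eq_add_neg]
  exact hK.add hT.neg

theorem weightedCoveringNumber_le_sum {ι : Type*} [Fintype ι] (x : ι → EuclideanSpace ℝ (Fin n))
    (w : ι → ℝ≥0) (h : ∀ y ∈ K, 1 ≤ ∑ i, w i * (x i +ᵥ T).indicator 1 y) :
    weightedCoveringNumber K T ≤ ((∑ i, w i : ℝ≥0) : ℝ≥0∞) := by
  let e := Fintype.equivFin ι
  have hcov : IsWeightedCovering K T (x ∘ e.symm) (w ∘ e.symm) := by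
    intro y hy
    refine (h y hy).trans_eq ?_
    exact (Equiv.sum_comp e.symm (fun i => w i * (x i +ᵥ T).indicator 1 y)).symm
  refine (iInf₂_le_of_le _ (x ∘ e.symm) (iInf₂_le_of_le (w ∘ e.symm) hcov ?_))
  rw [← Equiv.sum_comp e.symm w]
  rfl

theorem weightedCoveringNumber_le_of_subset_vadd {a : EuclideanSpace ℝ (Fin n)}
    (h : T ⊆ a +ᵥ T') : weightedCoveringNumber K T' ≤ weightedCoveringNumber K T := by
  refine le_iInf₂ fun N x => le_iInf₂ fun w hw => ?_
  refine weightedCoveringNumber_le_sum (fun i => x i + a) w fun y hy => (hw y hy).trans ?_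
  gcongr with i
  rw [add_vadd]
  exact Set.vadd_set_mono h

/-- The point `(r/s) k + ((s-r)/s) c` lies in `K`, and `s` times it is `r k + (s-r) c`. The
translation replaces the assumption `0 ∈ K`; covering numbers do not see it. -/
theorem smul_subset_vadd_smul (hK : Convex ℝ K) {c : EuclideanSpace ℝ (Fin n)} (hc : c ∈ K)
    {r s : ℝ} (hr : 0 < r) (hrs : r ≤ s) : r • K ⊆ (-(s - r) • c) +ᵥ s • K := by
  rintro _ ⟨k, hk, rfl⟩
  have hs : 0 < s := hr.trans_le hrs
  rw [Set.mem_vadd_set_iff_neg_vadd_mem]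
  refine ⟨(r / s) • k + ((s - r) / s) • c, hK hk hc (by positivity)
    (div_nonneg (by linarith) hs.le) (by field_simp; ring), ?_⟩
  simp only [smul_add, smul_smul, mul_div_cancel₀ _ hs.ne', neg_smul, neg_neg, vadd_eq_add]
  exact add_comm _ _

theorem weightedCoveringNumber_smul_antitoneOn (hK : Convex ℝ K) (hne : K.Nonempty) :
    AntitoneOn (fun r : ℝ => weightedCoveringNumber K (r • K)) (Set.Ioo 0 1) := by
  obtain ⟨c, hc⟩ := hne
  intro r hr s _ hrs
  exact weightedCoveringNumber_le_of_subset_vadd (smul_subset_vadd_smul hK hc hr.1 hrs)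

theorem tendsto_weightedCoveringNumber_smul (hK : Convex ℝ K) (hne : K.Nonempty) :
    Filter.Tendsto (fun r : ℝ => weightedCoveringNumber K (r • K)) (𝓝[<] 1)
      (𝓝 (⨅ r ∈ Set.Ioo (0 : ℝ) 1, weightedCoveringNumber K (r • K))) := by
  have := (weightedCoveringNumber_smul_antitoneOn hK hne).tendsto_nhdsWithin_Ioo_left
    ⟨1 / 2, by norm_num, by norm_num⟩ (OrderBot.bddBelow _)
  rwa [sInf_image] at this

/-- A finite measure that covers `K` by `T` can be discretised into a finite weighted covering by
any set `T'` containing a uniform neighbourhood of `T`. -/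
theorem weightedCoveringNumber_le_measure (hK : IsCompact K) (hT : IsCompact T)
    (μ : Measure (EuclideanSpace ℝ (Fin n))) [IsFiniteMeasure μ] {ε : ℝ} (hε : 0 < ε)
    (hTT' : ∀ t ∈ T, ∀ z, ‖z‖ < ε → t + z ∈ T')
    (h : ∀ y ∈ K, 1 ≤ μ {x | y - x ∈ T}) :
    weightedCoveringNumber K T' ≤ μ Set.univ := by
  classical
  set e := TopologicalSpace.denseSeq (EuclideanSpace ℝ (Fin n))
  -- Only vectors `x ∈ K - T` have a translate `x + T` meeting `K`. Finitely many dense points form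
  -- an `ε`-net of this compact set.
  obtain ⟨N, hN⟩ : ∃ N, ∀ x ∈ K - T, ∃ k ≤ N, dist (e k) x < ε := by
    have hcov : K - T ⊆ ⋃ N, ⋃ k ≤ N, Metric.ball (e k) ε := by
      intro x _
      obtain ⟨k, hk⟩ := (TopologicalSpace.denseRange_denseSeq _).exists_dist_lt x hε
      simp only [Set.mem_iUnion, Metric.mem_ball]
      exact ⟨k, k, le_rfl, hk⟩
    obtain ⟨N, hN⟩ := (isCompact_sub hK hT).elim_directed_cover (fun N : ℕ => ⋃ k ≤ N, Metric.ball (e k) ε)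
      (fun N => isOpen_biUnion fun _ _ => Metric.isOpen_ball) hcov
      (Monotone.directed_le fun a b hab =>
        Set.biUnion_subset_biUnion_left fun k (hk : k ≤ a) => hk.trans hab)
    refine ⟨N, fun x hx => ?_⟩
    have := hN hx
    simp only [Set.mem_iUnion, Metric.mem_ball] at this
    obtain ⟨k, hk, hd⟩ := this
    exact ⟨k, hk, by rwa [dist_comm]⟩
  -- Rounding to the net moves `x` by less than `ε`, so `y ∈ x + T` gives `y ∈ s x + T'`. The
  -- weights are the masses of the fibres of `s`.
  set s := SimpleFunc.nearestPt e N
  have hs : ∀ x ∈ K - T, dist (s x) x < ε := by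
    intro x hx
    obtain ⟨k, hk, hd⟩ := hN x hx
    have := SimpleFunc.edist_nearestPt_le e x hk
    rw [edist_dist, edist_dist, ENNReal.ofReal_le_ofReal_iff dist_nonneg] at this
    exact this.trans_lt hd
  have key : ∀ t : Finset (EuclideanSpace ℝ (Fin n)),
      ((∑ p ∈ t, (μ (s ⁻¹' {p})).toNNReal : ℝ≥0) : ℝ≥0∞) = ∑ p ∈ t, μ (s ⁻¹' {p}) := by
    intro t
    rw [ENNReal.ofNNReal_finsetSum]
    exact Finset.sum_congr rfl fun p _ => ENNReal.coe_toNNReal (measure_ne_top _ _)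
  calc weightedCoveringNumber K T'
      ≤ ((∑ p : s.range, (μ (s ⁻¹' {(p : EuclideanSpace ℝ (Fin n))})).toNNReal : ℝ≥0) : ℝ≥0∞) := ?_
    _ = μ Set.univ := by
        rw [Finset.sum_coe_sort s.range (fun p => (μ (s ⁻¹' {p})).toNNReal), key]
        exact s.sum_range_measure_preimage_singleton μ
  refine weightedCoveringNumber_le_sum (fun p : s.range => (p : EuclideanSpace ℝ (Fin n))) _ ?_
  intro y hy
  rw [Finset.sum_coe_sort s.range
    (fun p => (μ (s ⁻¹' {p})).toNNReal * (p +ᵥ T').indicator 1 y)]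
  have h1 : ∑ p ∈ s.range, (μ (s ⁻¹' {p})).toNNReal * (p +ᵥ T').indicator 1 y =
      ∑ p ∈ s.range.filter (fun p => y ∈ p +ᵥ T'), (μ (s ⁻¹' {p})).toNNReal := by
    rw [Finset.sum_filter]
    refine Finset.sum_congr rfl fun p _ => ?_
    by_cases hp : y ∈ p +ᵥ T' <;> simp [hp]
  rw [h1, ← ENNReal.coe_le_coe, key, s.sum_measure_preimage_singleton, ENNReal.coe_one]
  refine (h y hy).trans (measure_mono fun x (hx : y - x ∈ T) => ?_)
  have hxd := hs x ⟨y, hy, y - x, hx, by simp⟩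
  have : y ∈ s x +ᵥ T' := by
    refine ⟨(y - x) + (x - s x), hTT' _ hx _ (by rwa [← dist_eq_norm, dist_comm]), ?_⟩
    simp
  exact Finset.mem_coe.2 (Finset.mem_filter.2 ⟨s.mem_range_self x, this⟩)

theorem measure_reflect (T : Set (EuclideanSpace ℝ (Fin n))) (y : EuclideanSpace ℝ (Fin n)) :
    volume {x | y - x ∈ T} = volume T :=
  (Measure.measurePreserving_sub_left volume y).measure_preimage_equiv
    (f := (Homeomorph.subLeft y).toMeasurableEquiv) T

/-- As in `smul_subset_vadd_smul`, but with `c` free to move in a ball of radius `ρ` inside `K`,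
which leaves room `(s - r) ρ`. -/
theorem exists_forall_add_mem_smul (hK : Convex ℝ K) (hint : (interior K).Nonempty)
    {r s : ℝ} (hr : 0 < r) (hrs : r < s) :
    ∃ a : EuclideanSpace ℝ (Fin n), ∃ ε > 0, ∀ t ∈ r • K, ∀ z, ‖z‖ < ε → t + z ∈ a +ᵥ s • K := by
  obtain ⟨c, hc⟩ := hint
  obtain ⟨ρ, hρ, hball⟩ := Metric.mem_nhds_iff.1 (mem_interior_iff_mem_nhds.1 hc)
  have hs : 0 < s := hr.trans hrs
  have hsr : 0 < s - r := sub_pos.2 hrs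
  refine ⟨-(s - r) • c, (s - r) * ρ, by positivity, ?_⟩
  rintro _ ⟨k, hk, rfl⟩ z hz
  have hz' : c + (s - r)⁻¹ • z ∈ K := by
    refine hball ?_
    rw [mem_ball_iff_norm, add_sub_cancel_left, norm_smul, Real.norm_of_nonneg (by positivity),
      inv_mul_lt_iff₀ hsr]
    exact hz
  rw [Set.mem_vadd_set_iff_neg_vadd_mem]
  refine ⟨(r / s) • k + ((s - r) / s) • (c + (s - r)⁻¹ • z), hK hk hz' (by positivity)
    (by positivity) (by field_simp; ring), ?_⟩
  have h1 : s * (r / s) = r := mul_div_cancel₀ _ hs.ne'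
  have h2 : s * ((s - r) / s) = s - r := mul_div_cancel₀ _ hs.ne'
  have h3 : s * ((s - r) / s * (s - r)⁻¹) = 1 := by
    rw [← mul_assoc, h2, mul_inv_cancel₀ hsr.ne']
  simp only [smul_add, smul_smul, h1, h2, h3, neg_smul, neg_neg, vadd_eq_add, one_smul]
  abel

theorem weightedCoveringNumber_smul_le_measure (hK : IsCompact K) (hKc : Convex ℝ K)
    (hint : (interior K).Nonempty) {r s : ℝ} (hr : 0 < r) (hrs : r < s)
    (μ : Measure (EuclideanSpace ℝ (Fin n))) [IsFiniteMeasure μ]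
    (h : ∀ y ∈ K, 1 ≤ μ {x | y - x ∈ r • K}) :
    weightedCoveringNumber K (s • K) ≤ μ Set.univ := by
  obtain ⟨a, ε, hε, ha⟩ := exists_forall_add_mem_smul hKc hint hr hrs
  exact (weightedCoveringNumber_le_of_subset_vadd subset_rfl).trans
    (weightedCoveringNumber_le_measure hK (hK.smul r) μ hε ha h)

theorem weightedCoveringNumber_smul_le_volume_div (hK : IsCompact K) (hKc : Convex ℝ K)
    (hint : (interior K).Nonempty) {r s : ℝ} (hr : 0 < r) (hrs : r < s) (hr1 : r ≤ 1) :
    weightedCoveringNumber K (s • K) ≤ volume (K - K) / volume (r • K) := by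
  obtain ⟨c, hc⟩ := id hint
  have hcK := interior_subset hc
  have hpos : volume (r • K) ≠ 0 := by
    rw [Measure.addHaar_smul]
    have := (isOpen_interior.measure_pos volume hint).trans_le (measure_mono interior_subset)
    simp [this.ne', hr.ne']
  have hfin : volume (r • K) ≠ ∞ := (hK.smul r).measure_lt_top.ne
  set D : Set (EuclideanSpace ℝ (Fin n)) := K - r • K
  have hD : IsCompact D := isCompact_sub hK (hK.smul r)
  have hDK : volume D ≤ volume (K - K) := by
    have : D ⊆ ((1 - r) • c) +ᵥ (K - K) := by
      rintro _ ⟨k, hk, t, ht, rfl⟩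
      obtain ⟨t', ht', h⟩ := smul_subset_vadd_smul hKc hcK hr hr1 ht
      rw [one_smul] at ht'
      refine ⟨k - t', Set.sub_mem_sub hk ht', ?_⟩
      simp only [vadd_eq_add] at h ⊢
      rw [← h]
      module
    refine (measure_mono this).trans ?_
    rw [measure_vadd]
  -- For `y ∈ K` the set `y - rK` lies wholly in `D`, so it has `μ`-measure exactly 1.
  set μ : Measure (EuclideanSpace ℝ (Fin n)) := (volume (r • K))⁻¹ • volume.restrict D
  have hμ : μ Set.univ = volume D / volume (r • K) := by
    simp [μ, div_eq_mul_inv, mul_comm]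
  have : IsFiniteMeasure μ := ⟨by
    rw [hμ]; exact ENNReal.div_lt_top hD.measure_lt_top.ne hpos⟩
  calc weightedCoveringNumber K (s • K) ≤ μ Set.univ := by
        refine weightedCoveringNumber_smul_le_measure hK hKc hint hr hrs μ fun y hy => ?_
        have hsub : {x | y - x ∈ r • K} ⊆ D := fun x hx => ⟨y, hy, y - x, hx, by simp⟩
        simp only [μ, Measure.smul_apply, smul_eq_mul]
        rw [Measure.restrict_eq_self _ hsub, measure_reflect, ENNReal.inv_mul_cancel hpos hfin]
    _ ≤ _ := by rw [hμ]; gcongr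

theorem iInf_weightedCoveringNumber_smul_le (hK : IsCompact K) (hKc : Convex ℝ K)
    (hint : (interior K).Nonempty) :
    ⨅ r ∈ Set.Ioo (0 : ℝ) 1, weightedCoveringNumber K (r • K) ≤ volume (K - K) / volume K := by
  have hpos : volume K ≠ 0 :=
    ((isOpen_interior.measure_pos volume hint).trans_le (measure_mono interior_subset)).ne'
  have hlim : Filter.Tendsto (fun r : ℝ => volume (K - K) / (ENNReal.ofReal (r ^ n) * volume K))
      (𝓝[<] 1) (𝓝 (volume (K - K) / (ENNReal.ofReal (1 ^ n) * volume K))) := by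
    refine Filter.Tendsto.mono_left ?_ nhdsWithin_le_nhds
    refine ENNReal.Tendsto.const_div (ENNReal.Tendsto.mul_const ?_ (Or.inl ?_)) ?_
    · exact (ENNReal.continuous_ofReal.comp (continuous_pow n)).tendsto 1
    · simp
    · refine Or.inr ?_
      exact (isCompact_sub hK hK).measure_lt_top.ne
  simp only [one_pow, ENNReal.ofReal_one, one_mul] at hlim
  refine ge_of_tendsto hlim ?_
  filter_upwards [Ioo_mem_nhdsLT (show (0 : ℝ) < 1 by norm_num)] with r hr
  have := weightedCoveringNumber_smul_le_volume_div hK hKc hint hr.1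
    (show r < (r + 1) / 2 by linarith [hr.2]) hr.2.le
  rw [Measure.addHaar_smul, finrank_euclideanSpace_fin, abs_of_nonneg (pow_nonneg hr.1.le _)] at this
  exact (iInf₂_le _ ⟨by linarith [hr.1], by linarith [hr.2]⟩).trans this

theorem fractionalIlluminationNumber_le_weightedCoveringNumber (hn : 1 ≤ n)
    (hK : IsCompact K) (hKc : Convex ℝ K)
    (h0 : 0 ∈ interior K) {r : ℝ} (hr : 0 < r) (hr1 : r < 1) :
    fractionalIlluminationNumber K ≤ weightedCoveringNumber K (r • K) := by
  classical
  have : Nonempty (Fin n) := ⟨⟨0, hn⟩⟩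
  obtain ⟨u₀, hu₀⟩ := NormedSpace.sphere_nonempty (E := EuclideanSpace ℝ (Fin n)) (x := 0) (r := 1)
    |>.2 zero_le_one
  have hrK : r • K ⊆ interior K := by
    rintro _ ⟨k, hk, rfl⟩
    have := hKc.combo_interior_self_mem_interior h0 hk (sub_pos.2 hr1) hr.le (by ring)
    simpa using this
  refine le_iInf₂ fun N x => le_iInf₂ fun w hw => ?_
  -- If `b ∈ x i + rK`, then `b - x i` lies in `rK`, inside the interior of `K`. A translate with `x
  -- i = 0` contains no boundary point, so its direction is arbitrary.
  let u : Fin N → Metric.sphere (0 : EuclideanSpace ℝ (Fin n)) 1 := fun i =>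
    if h : x i = 0 then ⟨u₀, hu₀⟩ else
      ⟨-(‖x i‖⁻¹ • x i), by simp [norm_smul, h]⟩
  refine iInf₂_le_of_le _ u (iInf₂_le_of_le w ?_ le_rfl)
  intro b hb
  have hbK : b ∈ K := hK.isClosed.frontier_subset hb
  refine (hw b hbK).trans ?_
  refine Finset.sum_le_sum fun i _ => mul_le_mul_right ?_ _
  by_cases hbi : b ∈ x i +ᵥ r • K
  · obtain ⟨k, hk, hkb⟩ := id hbi
    have hx : x i ≠ 0 := by
      intro h
      rw [h] at hkb
      simp only [vadd_eq_add, zero_add] at hkb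
      rw [hkb] at hk
      exact hb.2 (hrK hk)
    have : b ∈ illuminatedBy K (u i) := by
      refine ⟨hb, ‖x i‖, norm_nonneg _, ?_⟩
      have : b + ‖x i‖ • (u i : EuclideanSpace ℝ (Fin n)) = k := by
        simp only [u, dif_neg hx, smul_neg, smul_smul]
        rw [mul_inv_cancel₀ (norm_ne_zero_iff.2 hx), one_smul, ← hkb]
        simp
      rw [this]
      exact hrK hk
    simp [this, hbi]
  · simp [hbi]

end Covering

/-! ### The Rogers–Shephard inequality -/

section RogersShephard

/-- Induction on `b`: the derivative of `t^(a+1) (1-t)^(b+1)` integrates to zero over `[0, 1]`. -/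
theorem integral_pow_mul_one_sub_pow (a b : ℕ) :
    ∫ t in (0 : ℝ)..1, t ^ a * (1 - t) ^ b =
      (a.factorial * b.factorial : ℝ) / (a + b + 1).factorial := by
  induction b generalizing a with
  | zero =>
    have := a.factorial_ne_zero
    simp only [pow_zero, mul_one, integral_pow, add_zero, Nat.factorial_succ]
    push_cast
    field_simp
    simp
  | succ b ih =>
    have hparts : ∫ t in (0 : ℝ)..1,
        (((a + 1 : ℕ) : ℝ) * (t ^ a * (1 - t) ^ (b + 1)) -
          ((b + 1 : ℕ) : ℝ) * (t ^ (a + 1) * (1 - t) ^ b)) = 0 := by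
      rw [intervalIntegral.integral_eq_sub_of_hasDerivAt
        (f := fun t : ℝ => t ^ (a + 1) * (1 - t) ^ (b + 1))]
      · simp
      · intro t _
        have h1 := hasDerivAt_pow (a + 1) t
        have h2 := ((hasDerivAt_id t).const_sub 1).pow (b + 1)
        refine (h1.mul h2).congr_deriv ?_
        simp only [id, Nat.add_sub_cancel, Pi.pow_apply]
        ring
      · apply Continuous.intervalIntegrable
        fun_prop
    rw [intervalIntegral.integral_sub (Continuous.intervalIntegrable (by fun_prop) _ _)
      (Continuous.intervalIntegrable (by fun_prop) _ _),
      intervalIntegral.integral_const_mul, intervalIntegral.integral_const_mul, ih,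
      sub_eq_zero] at hparts
    have ha : ((a + 1 : ℕ) : ℝ) ≠ 0 := by positivity
    rw [← mul_right_inj' ha, hparts, show a + 1 + b + 1 = a + (b + 1) + 1 by ring,
      Nat.factorial_succ a, Nat.factorial_succ b]
    push_cast
    ring

variable {n : ℕ} {K : Set (EuclideanSpace ℝ (Fin n))}

theorem lintegral_volume_inter_translate (hK : IsCompact K) :
    ∫⁻ x, volume {y | y ∈ K ∧ y - x ∈ K} = volume K * volume K := by
  set S : Set (EuclideanSpace ℝ (Fin n) × EuclideanSpace ℝ (Fin n)) :=
    {p | p.2 ∈ K ∧ p.2 - p.1 ∈ K}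
  have hS : MeasurableSet S :=
    ((hK.isClosed.preimage continuous_snd).inter
      (hK.isClosed.preimage (continuous_snd.sub continuous_fst))).measurableSet
  have h1 := Measure.prod_apply (μ := volume) (ν := volume) hS
  have h2 := Measure.prod_apply_symm (μ := volume) (ν := volume) hS
  calc ∫⁻ x, volume {y | y ∈ K ∧ y - x ∈ K} = (volume.prod volume) S := h1.symm
    _ = ∫⁻ y, K.indicator (fun _ => volume K) y := by
      rw [h2]
      refine lintegral_congr fun y => ?_
      by_cases hy : y ∈ K
      · rw [Set.indicator_of_mem hy, ← measure_reflect K y]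
        congr 1
        ext x
        simp [S, hy]
      · simp [S, hy]
    _ = volume K * volume K := by
      rw [lintegral_indicator hK.isClosed.measurableSet]
      simp

/-- If `x = (1-t)(a-b)`, then `K ∩ (x + K)` contains the copy `(1-t) a + t K`. -/
theorem le_volume_inter_translate (hKc : Convex ℝ K) {t : ℝ}
    (ht : 0 ≤ t) (ht1 : t ≤ 1) {x : EuclideanSpace ℝ (Fin n)} (hx : x ∈ (1 - t) • (K - K)) :
    ENNReal.ofReal (t ^ n) * volume K ≤ volume {y | y ∈ K ∧ y - x ∈ K} := by
  obtain ⟨_, ⟨a, ha, b, hb, rfl⟩, rfl⟩ := hx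
  have hsub : (((1 - t) • a) +ᵥ t • K) ⊆ {y | y ∈ K ∧ y - (1 - t) • (a - b) ∈ K} := by
    rintro _ ⟨_, ⟨k, hk, rfl⟩, rfl⟩
    refine ⟨hKc ha hk (by linarith) ht (by ring), ?_⟩
    have := hKc hb hk (show 0 ≤ 1 - t by linarith) ht (by ring)
    convert this using 1
    simp only [vadd_eq_add]
    module
  refine le_trans ?_ (measure_mono hsub)
  rw [measure_vadd, Measure.addHaar_smul, finrank_euclideanSpace_fin,
    abs_of_nonneg (pow_nonneg ht _)]

/-- The Rogers–Shephard inequality for the difference body. -/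
theorem volume_sub_self_div_le (hn : 1 ≤ n) (hK : IsCompact K) (hKc : Convex ℝ K)
    (hint : (interior K).Nonempty) :
    volume (K - K) / volume K ≤ ((2 * n).choose n : ℝ≥0∞) := by
  have hpos : volume K ≠ 0 :=
    ((isOpen_interior.measure_pos volume hint).trans_le (measure_mono interior_subset)).ne'
  have hfin : volume K ≠ ∞ := hK.measure_lt_top.ne
  have hn0 : n ≠ 0 := by omega
  set f : EuclideanSpace ℝ (Fin n) → ℝ≥0∞ := fun x => volume {y | y ∈ K ∧ y - x ∈ K} with hf
  have hf_fin : ∀ x, f x ≠ ∞ := fun x =>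
    ((measure_mono fun y hy => hy.1).trans_lt hK.measure_lt_top).ne
  have hf_meas : Measurable f := by
    have hS : MeasurableSet {p : EuclideanSpace ℝ (Fin n) × EuclideanSpace ℝ (Fin n) |
        p.2 ∈ K ∧ p.2 - p.1 ∈ K} :=
      ((hK.isClosed.preimage continuous_snd).inter
        (hK.isClosed.preimage (continuous_snd.sub continuous_fst))).measurableSet
    exact measurable_measure_prodMk_left hS
  -- With this normalisation `{h ≥ t}` contains `(1-t)(K - K)` for `0 < t ≤ 1`. The layer-cake
  -- formula for `h^n`, whose integral is `vol K`, then bounds `vol(K - K)`.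
  set h : EuclideanSpace ℝ (Fin n) → ℝ := fun x => ((f x / volume K).toReal) ^ ((n : ℝ)⁻¹) with hh
  have hh0 : ∀ x, 0 ≤ h x := fun x => Real.rpow_nonneg ENNReal.toReal_nonneg _
  have hhn : ∀ x, ENNReal.ofReal (h x ^ n) = f x / volume K := by
    intro x
    rw [hh]
    simp only
    rw [Real.rpow_inv_natCast_pow ENNReal.toReal_nonneg hn0,
      ENNReal.ofReal_toReal (ENNReal.div_ne_top (hf_fin x) hpos)]
  have hh_meas : Measurable h := by
    rw [hh]
    exact (hf_meas.div_const _).ennreal_toReal.pow_const _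
  have hlayer := lintegral_comp_eq_lintegral_meas_le_mul (f := h)
    (g := fun t => (n : ℝ) * t ^ (n - 1)) volume (Filter.Eventually.of_forall hh0)
    hh_meas.aemeasurable (fun t _ => Continuous.intervalIntegrable (by fun_prop) _ _)
    (by
      filter_upwards [ae_restrict_mem measurableSet_Ioi] with t ht
      have : (0 : ℝ) ≤ t := le_of_lt ht
      positivity)
  have hcast : ((n - 1 : ℕ) : ℝ) + 1 = n := by
    rw [← Nat.cast_add_one, Nat.sub_add_cancel hn]
  have hprim : ∀ s : ℝ, ∫ t in (0 : ℝ)..s, (n : ℝ) * t ^ (n - 1) = s ^ n := by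
    intro s
    rw [intervalIntegral.integral_const_mul, integral_pow, hcast, Nat.sub_add_cancel hn,
      zero_pow hn0]
    field_simp
    simp
  simp only [hprim, hhn] at hlayer
  have hleft : ∫⁻ x, f x / volume K = volume K := by
    simp only [div_eq_mul_inv]
    rw [lintegral_mul_const _ hf_meas, hf, lintegral_volume_inter_translate hK, mul_assoc,
      ENNReal.mul_inv_cancel hpos hfin, mul_one]
  rw [hleft] at hlayer
  have hlower : volume (K - K) * ENNReal.ofReal (((2 * n).choose n : ℝ)⁻¹) ≤ volume K := by
    -- The Beta integral: `n (n-1)! n! / (2n)!` is the inverse central binomial coefficient.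
    have hbeta : ENNReal.ofReal (((2 * n).choose n : ℝ)⁻¹) =
        ∫⁻ t in Set.Ioc (0 : ℝ) 1, ENNReal.ofReal ((1 - t) ^ n * (n * t ^ (n - 1))) := by
      rw [← ofReal_integral_eq_lintegral_ofReal]
      · rw [← intervalIntegral.integral_of_le zero_le_one]
        have : ∀ t : ℝ, (1 - t) ^ n * (n * t ^ (n - 1)) = n * (t ^ (n - 1) * (1 - t) ^ n) :=
          fun t => by ring
        simp only [this]
        rw [intervalIntegral.integral_const_mul, integral_pow_mul_one_sub_pow,
          Nat.cast_choose ℝ (show n ≤ 2 * n by omega), show n - 1 + n + 1 = 2 * n by omega,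
          show 2 * n - n = n by omega]
        have h1 : (n : ℝ) * (n - 1).factorial = n.factorial := by
          exact_mod_cast Nat.mul_factorial_pred hn0
        rw [inv_div, ← h1]
        ring_nf
      · exact (Continuous.integrableOn_Icc (by fun_prop)).mono_set Set.Ioc_subset_Icc_self
      · filter_upwards [ae_restrict_mem measurableSet_Ioc] with t ht
        have h1 : 0 ≤ 1 - t := by linarith [ht.2]
        have h2 : 0 ≤ t := ht.1.le
        positivity
    rw [hbeta, ← lintegral_const_mul _ (by fun_prop)]
    refine le_trans ?_ hlayer.ge
    refine le_trans ?_ (lintegral_mono_set (Set.Ioc_subset_Ioi_self : Set.Ioc (0 : ℝ) 1 ⊆ _))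
    refine setLIntegral_mono' measurableSet_Ioc fun t ht => ?_
    have h1 : 0 ≤ 1 - t := by linarith [ht.2]
    rw [ENNReal.ofReal_mul (pow_nonneg h1 _), ← mul_assoc]
    refine mul_le_mul_left ?_ _
    have hD : volume (K - K) * ENNReal.ofReal ((1 - t) ^ n) = volume ((1 - t) • (K - K)) := by
      rw [Measure.addHaar_smul, finrank_euclideanSpace_fin, abs_of_nonneg (pow_nonneg h1 _),
        mul_comm]
    rw [hD]
    refine measure_mono fun x hx => ?_
    have hle := le_volume_inter_translate hKc ht.1.le ht.2 hx
    have h2 : ENNReal.ofReal (t ^ n) ≤ ENNReal.ofReal (h x ^ n) := by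
      rw [hhn, ENNReal.le_div_iff_mul_le (Or.inl hpos) (Or.inl hfin)]
      exact hle
    rw [ENNReal.ofReal_le_ofReal_iff (pow_nonneg (hh0 x) _)] at h2
    exact (pow_le_pow_iff_left₀ ht.1.le (hh0 x) hn0).1 h2
  have hc : (0 : ℝ) < (2 * n).choose n := by
    exact_mod_cast Nat.choose_pos (by omega)
  rw [ENNReal.ofReal_inv_of_pos hc, ENNReal.ofReal_natCast] at hlower
  refine ENNReal.div_le_of_le_mul ?_
  rw [← div_eq_mul_inv, ENNReal.div_le_iff (by exact_mod_cast hc.ne') (ENNReal.natCast_ne_top _)]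
    at hlower
  rwa [mul_comm]

end RogersShephard

/-! ### Lower bounds for parallelotopes -/

section Parallelotope

/-- Double counting: each `A i` holds at most one of the `2^n` points, so summing the covering
inequalities counts each weight at most once. -/
theorem two_pow_le_sum_of_separated {α : Type*} {n N : ℕ} (P : Finset (Fin n) → α)
    (A : Fin N → Set α) (w : Fin N → ℝ≥0)
    (hcov : ∀ S, 1 ≤ ∑ i, w i * (A i).indicator 1 (P S))
    (hsep : ∀ i S T, P S ∈ A i → P T ∈ A i → S = T) : (2 : ℝ≥0) ^ n ≤ ∑ i, w i := by
  classical
  calc (2 : ℝ≥0) ^ n = ∑ _S : Finset (Fin n), (1 : ℝ≥0) := by simp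
    _ ≤ ∑ S, ∑ i, w i * (A i).indicator 1 (P S) := Finset.sum_le_sum fun S _ => hcov S
    _ = ∑ i, w i * ∑ S, (A i).indicator 1 (P S) := by
      rw [Finset.sum_comm]
      simp only [Finset.mul_sum]
    _ ≤ ∑ i, w i := by
      refine Finset.sum_le_sum fun i _ => mul_le_of_le_one_right' ?_
      by_cases h : ∃ S, P S ∈ A i
      · obtain ⟨S, hS⟩ := h
        rw [Finset.sum_eq_single S]
        · simp [hS]
        · intro T _ hT
          exact Set.indicator_of_notMem (fun h => hT (hsep i T S h hS)) _
        · simp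
      · push Not at h
        simp [h]

variable {n : ℕ} {K : Set (EuclideanSpace ℝ (Fin n))}
  {b : Module.Basis (Fin n) ℝ (EuclideanSpace ℝ (Fin n))} {c : EuclideanSpace ℝ (Fin n)}

theorem repr_vertex (S : Finset (Fin n)) (i : Fin n) :
    b.repr ((c + ∑ j ∈ S, b j) - c) i = if i ∈ S then 1 else 0 := by
  classical
  simp [Finsupp.single_apply]

theorem mem_vadd_parallelepiped_iff (y : EuclideanSpace ℝ (Fin n)) :
    y ∈ c +ᵥ parallelepiped b ↔ ∀ i, b.repr (y - c) i ∈ Set.Icc (0 : ℝ) 1 := by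
  rw [Set.mem_vadd_set_iff_neg_vadd_mem, parallelepiped_basis_eq]
  simp only [vadd_eq_add, neg_add_eq_sub, Set.mem_ofPred_eq]

theorem repr_mem_Ioo_of_mem_interior {y : EuclideanSpace ℝ (Fin n)}
    (hy : y ∈ interior (c +ᵥ parallelepiped b)) (i : Fin n) :
    b.repr (y - c) i ∈ Set.Ioo (0 : ℝ) 1 := by
  have hcont : Filter.Tendsto (fun ε : ℝ => y + ε • b i) (𝓝 0) (𝓝 y) := by
    have : Continuous (fun ε : ℝ => y + ε • b i) := by fun_prop
    simpa using this.tendsto 0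
  obtain ⟨δ, hδ, hball⟩ := Metric.mem_nhds_iff.1
    (hcont.eventually (isOpen_interior.mem_nhds hy))
  have hmem : ∀ ε : ℝ, |ε| < δ → b.repr (y - c) i + ε ∈ Set.Icc (0 : ℝ) 1 := by
    intro ε hε
    have h1 : y + ε • b i ∈ interior (c +ᵥ parallelepiped b) :=
      hball (show ε ∈ Metric.ball 0 δ by simpa using hε)
    have h2 := (mem_vadd_parallelepiped_iff _).1 (interior_subset h1) i
    rw [show y + ε • b i - c = (y - c) + ε • b i by abel] at h2
    simpa using h2
  have h1 := hmem (δ / 2) (by rw [abs_of_pos (by positivity)]; linarith)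
  have h2 := hmem (-(δ / 2)) (by rw [abs_neg, abs_of_pos (by positivity)]; linarith)
  exact ⟨by linarith [h2.1], by linarith [h1.2]⟩

theorem vertex_mem (S : Finset (Fin n)) : (c + ∑ j ∈ S, b j) ∈ c +ᵥ parallelepiped b := by
  rw [mem_vadd_parallelepiped_iff]
  intro i
  rw [repr_vertex]
  split_ifs <;> simp

/-- Distinct vertices differ by 1 in some coordinate, while a translate of the `r`-copy has width
only `r < 1` in each. -/
theorem two_pow_le_weightedCoveringNumber_parallelotope (hK : IsParallelotope K) {r : ℝ}
    (hr : r ∈ Set.Ioo (0 : ℝ) 1) : 2 ^ n ≤ weightedCoveringNumber K (r • K) := by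
  obtain ⟨b, c, rfl⟩ := hK
  refine le_iInf₂ fun N x => le_iInf₂ fun w hw => ?_
  have key := two_pow_le_sum_of_separated (fun S => c + ∑ j ∈ S, b j)
    (fun i => x i +ᵥ r • (c +ᵥ parallelepiped b)) w (fun S => hw _ (vertex_mem S)) ?_
  · exact_mod_cast ENNReal.coe_le_coe.2 key
  have aux : ∀ (a : EuclideanSpace ℝ (Fin n)) (S T : Finset (Fin n)),
      (c + ∑ j ∈ S, b j) ∈ a +ᵥ r • (c +ᵥ parallelepiped b) →
      (c + ∑ j ∈ T, b j) ∈ a +ᵥ r • (c +ᵥ parallelepiped b) → S ⊆ T := by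
    rintro a S T ⟨_, ⟨k, hk, rfl⟩, hS⟩ ⟨_, ⟨l, hl, rfl⟩, hT⟩ i hiS
    by_contra hiT
    have h1 := repr_vertex (b := b) (c := c) S i
    have h2 := repr_vertex (b := b) (c := c) T i
    rw [if_pos hiS, ← hS] at h1
    rw [if_neg hiT, ← hT] at h2
    have hk' := (mem_vadd_parallelepiped_iff _).1 hk i
    have hl' := (mem_vadd_parallelepiped_iff _).1 hl i
    simp only [vadd_eq_add, map_sub, map_add, map_smul, Finsupp.coe_sub, Finsupp.coe_add,
      Finsupp.coe_smul, Pi.sub_apply, Pi.add_apply, Pi.smul_apply, smul_eq_mul, Set.mem_Icc]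
      at h1 h2 hk' hl'
    have : r * ((b.repr k i - b.repr c i) - (b.repr l i - b.repr c i)) = 1 := by linarith
    nlinarith [hr.1, hr.2]
  exact fun i S T hS hT => (aux _ S T hS hT).antisymm (aux _ T S hT hS)

theorem two_pow_le_fractionalIlluminationNumber_parallelotope (hn : 1 ≤ n)
    (hK : IsParallelotope K) : 2 ^ n ≤ fractionalIlluminationNumber K := by
  obtain ⟨b, c, rfl⟩ := hK
  refine le_iInf₂ fun N u => le_iInf₂ fun w hw => ?_
  have key := two_pow_le_sum_of_separated (fun S => c + ∑ j ∈ S, b j)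
    (fun i => illuminatedBy (c +ᵥ parallelepiped b) (u i)) w (fun S => hw _ ?_) ?_
  · exact_mod_cast ENNReal.coe_le_coe.2 key
  · refine ⟨subset_closure (vertex_mem S), fun h => ?_⟩
    have := repr_mem_Ioo_of_mem_interior h ⟨0, hn⟩
    rw [repr_vertex] at this
    split_ifs at this <;> simp at this
  have aux : ∀ i (S T : Finset (Fin n)),
      (c + ∑ j ∈ S, b j) ∈ illuminatedBy (c +ᵥ parallelepiped b) (u i) →
      (c + ∑ j ∈ T, b j) ∈ illuminatedBy (c +ᵥ parallelepiped b) (u i) → S ⊆ T := by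
    rintro i S T ⟨-, s, hs, hS⟩ ⟨-, t, ht, hT⟩ j hjS
    by_contra hjT
    have h1 := repr_mem_Ioo_of_mem_interior hS j
    have h2 := repr_mem_Ioo_of_mem_interior hT j
    rw [add_sub_right_comm, map_add, Finsupp.add_apply, repr_vertex, map_smul,
      Finsupp.smul_apply, smul_eq_mul] at h1 h2
    rw [if_pos hjS] at h1
    rw [if_neg hjT] at h2
    -- From coordinate 1 the ray must decrease to get inside, from coordinate 0 it must increase;
    -- one direction cannot do both.
    have h3 : b.repr (u i : EuclideanSpace ℝ (Fin n)) j < 0 := by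
      by_contra h
      have := mul_nonneg hs (not_lt.1 h)
      linarith [h1.2]
    have := mul_nonpos_of_nonneg_of_nonpos ht h3.le
    linarith [h2.1]
  exact fun i S T hS hT => (aux i S T hS hT).antisymm (aux i T S hT hS)

end Parallelotope

/-! ### Linear programming duality -/

section Duality

variable {n : ℕ} {K : Set (EuclideanSpace ℝ (Fin n))}

/-- The function `g` is dominated on `K` by the covering function of some finite measure of total
mass `t`, with respect to some homothetic copy `r • K`, `0 < r < 1`. -/
def IsDominatedWithMass (K : Set (EuclideanSpace ℝ (Fin n))) (g : EuclideanSpace ℝ (Fin n) → ℝ)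
    (t : ℝ) : Prop :=
  ∃ μ : Measure (EuclideanSpace ℝ (Fin n)), IsFiniteMeasure μ ∧ μ.real Set.univ = t ∧
    ∃ r ∈ Set.Ioo (0 : ℝ) 1, ∀ y ∈ K, g y ≤ μ.real {x | y - x ∈ r • K}

theorem IsDominatedWithMass.nonneg {g : EuclideanSpace ℝ (Fin n) → ℝ} {t : ℝ}
    (h : IsDominatedWithMass K g t) : 0 ≤ t := by
  obtain ⟨μ, -, rfl, -⟩ := h
  exact measureReal_nonneg

theorem IsDominatedWithMass.smul {g : EuclideanSpace ℝ (Fin n) → ℝ} {t : ℝ}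
    (h : IsDominatedWithMass K g t) {c : ℝ} (hc : 0 ≤ c) :
    IsDominatedWithMass K (c • g) (c * t) := by
  obtain ⟨μ, _, rfl, r, hr, hg⟩ := h
  refine ⟨c.toNNReal • μ, inferInstance, ?_, r, hr, fun y hy => ?_⟩
  · simp [measureReal_nnreal_smul_apply, hc]
  · rw [measureReal_nnreal_smul_apply, Real.coe_toNNReal _ hc]
    exact mul_le_mul_of_nonneg_left (hg y hy) hc

theorem smul_subset_smul_of_le (hKc : Convex ℝ K) (h0 : (0 : EuclideanSpace ℝ (Fin n)) ∈ K)
    {r s : ℝ} (hr : 0 < r) (hrs : r ≤ s) : r • K ⊆ s • K := by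
  simpa using smul_subset_vadd_smul hKc h0 hr hrs

/-- The existential `r` allows two dominations to be added: with `0 ∈ K` the copies are nested, so
both pass to the larger factor. -/
theorem IsDominatedWithMass.add (hKc : Convex ℝ K) (h0 : (0 : EuclideanSpace ℝ (Fin n)) ∈ K)
    {g h : EuclideanSpace ℝ (Fin n) → ℝ} {t s : ℝ}
    (hg : IsDominatedWithMass K g t) (hh : IsDominatedWithMass K h s) :
    IsDominatedWithMass K (g + h) (t + s) := by
  obtain ⟨μ, _, rfl, r, hr, hg⟩ := hg
  obtain ⟨ν, _, rfl, q, hq, hh⟩ := hh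
  refine ⟨μ + ν, inferInstance, ?_, max r q, ⟨lt_max_of_lt_left hr.1, max_lt hr.2 hq.2⟩,
    fun y hy => ?_⟩
  · rw [measureReal_add_apply]
  · rw [measureReal_add_apply]
    refine add_le_add ((hg y hy).trans (measureReal_mono ?_)) ((hh y hy).trans (measureReal_mono ?_))
    · exact fun x hx => smul_subset_smul_of_le hKc h0 hr.1 (le_max_left _ _) hx
    · exact fun x hx => smul_subset_smul_of_le hKc h0 hq.1 (le_max_right _ _) hx

theorem volume_ne_zero_of_interior_nonempty (hint : (interior K).Nonempty) : volume K ≠ 0 :=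
  ((isOpen_interior.measure_pos volume hint).trans_le (measure_mono interior_subset)).ne'

/-- A large multiple of Lebesgue measure on `K - K/2` suffices. Hence the infimal dominating mass of
a bounded function is taken over a nonempty set. -/
theorem exists_isDominatedWithMass (hK : IsCompact K)
    (hint : (interior K).Nonempty) {g : EuclideanSpace ℝ (Fin n) → ℝ} {C : ℝ}
    (hg : ∀ y ∈ K, |g y| ≤ C) : ∃ t, IsDominatedWithMass K g t := by
  have hc : IsCompact (K - (1 / 2 : ℝ) • K) := isCompact_sub hK (hK.smul _)
  have : IsFiniteMeasure ((volume : Measure (EuclideanSpace ℝ (Fin n))).restrict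
    (K - (1 / 2 : ℝ) • K)) := ⟨by simpa using hc.measure_lt_top⟩
  have hpos : volume ((1 / 2 : ℝ) • K) ≠ 0 := by
    rw [Measure.addHaar_smul]
    simp [volume_ne_zero_of_interior_nonempty hint]
  have hV : 0 < volume.real ((1 / 2 : ℝ) • K) :=
    ENNReal.toReal_pos hpos (hK.smul (1 / 2 : ℝ)).measure_lt_top.ne
  refine ⟨_, (C.toNNReal / (volume.real ((1 / 2 : ℝ) • K)).toNNReal) • volume.restrict
    (K - (1 / 2 : ℝ) • K), inferInstance, rfl, 1 / 2, by norm_num, fun y hy => ?_⟩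
  have hC : 0 ≤ C := (abs_nonneg _).trans (hg y hy)
  have hsub : {x | y - x ∈ (1 / 2 : ℝ) • K} ⊆ K - (1 / 2 : ℝ) • K :=
    fun x hx => ⟨y, hy, y - x, hx, by simp⟩
  have hmeas : (volume.restrict (K - (1 / 2 : ℝ) • K)).real {x | y - x ∈ (1 / 2 : ℝ) • K} =
      volume.real ((1 / 2 : ℝ) • K) := by
    rw [measureReal_def, Measure.restrict_eq_self _ hsub, measure_reflect, measureReal_def]
  rw [measureReal_nnreal_smul_apply, hmeas, NNReal.coe_div, Real.coe_toNNReal _ hC,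
    Real.coe_toNNReal _ hV.le, div_mul_cancel₀ _ hV.ne']
  exact (le_abs_self _).trans (hg y hy)

theorem le_of_isDominatedWithMass_const (hK : IsCompact K) (hKc : Convex ℝ K)
    (hint : (interior K).Nonempty) {M : ℝ≥0}
    (hM : ∀ r ∈ Set.Ioo (0 : ℝ) 1, M ≤ weightedCoveringNumber K (r • K)) {c t : ℝ}
    (h : IsDominatedWithMass K (c • 1) t) : c * M ≤ t := by
  rcases le_or_gt c 0 with hc | hc
  · exact (mul_nonpos_of_nonpos_of_nonneg hc M.2).trans h.nonneg
  have h' := h.smul (inv_nonneg.2 hc.le)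
  rw [smul_smul, inv_mul_cancel₀ hc.ne', one_smul] at h'
  obtain ⟨μ, _, ht, r, hr, hg⟩ := h'
  have hcov : weightedCoveringNumber K (((r + 1) / 2) • K) ≤ μ Set.univ := by
    refine weightedCoveringNumber_smul_le_measure hK hKc hint hr.1 (by linarith [hr.2]) μ
      fun y hy => ?_
    have := hg y hy
    rw [Pi.one_apply, measureReal_def] at this
    rw [← ENNReal.ofReal_one]
    exact ENNReal.ofReal_le_of_le_toReal this
  have h1 := (hM _ ⟨by linarith [hr.1], by linarith [hr.2]⟩).trans hcov
  have h2 : (M : ℝ) ≤ μ.real Set.univ := by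
    rw [measureReal_def]
    simpa using ENNReal.toReal_mono (measure_ne_top μ _) h1
  rw [ht] at h2
  rwa [← div_eq_inv_mul, le_div_iff₀ hc, mul_comm] at h2

/-- Linear programming duality for the weighted covering numbers of `K` by `r • K`, `r < 1`: a
lower bound `M` is witnessed by a linear functional, a finitely additive weight on `K`. -/
theorem exists_dual_functional (hK : IsCompact K) (hKc : Convex ℝ K)
    (h0 : 0 ∈ interior K) {M : ℝ≥0}
    (hM : ∀ r ∈ Set.Ioo (0 : ℝ) 1, M ≤ weightedCoveringNumber K (r • K)) :
    ∃ Λ : (EuclideanSpace ℝ (Fin n) → ℝ) →ₗ[ℝ] ℝ, Λ 1 = M ∧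
      ∀ g, (∃ C, ∀ y ∈ K, |g y| ≤ C) → ∀ t, IsDominatedWithMass K g t → Λ g ≤ t := by
  have hint : (interior K).Nonempty := ⟨0, h0⟩
  have h0K : 0 ∈ K := interior_subset h0
  let B : Submodule ℝ (EuclideanSpace ℝ (Fin n) → ℝ) :=
    { carrier := {g | ∃ C, ∀ y ∈ K, |g y| ≤ C}
      add_mem' := by
        rintro g h ⟨C, hC⟩ ⟨D, hD⟩
        exact ⟨C + D, fun y hy => (abs_add_le _ _).trans (add_le_add (hC y hy) (hD y hy))⟩
      zero_mem' := ⟨0, fun y _ => by simp⟩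
      smul_mem' := by
        rintro c g ⟨C, hC⟩
        refine ⟨|c| * C, fun y hy => ?_⟩
        rw [Pi.smul_apply, smul_eq_mul, abs_mul]
        exact mul_le_mul_of_nonneg_left (hC y hy) (abs_nonneg c) }
  let p : B → ℝ := fun g => sInf {t | IsDominatedWithMass K g t}
  have hbdd : ∀ g : EuclideanSpace ℝ (Fin n) → ℝ, BddBelow {t | IsDominatedWithMass K g t} :=
    fun g => ⟨0, fun t ht => ht.nonneg⟩
  have hne : ∀ g : B, {t | IsDominatedWithMass K g t}.Nonempty := fun g => by
    obtain ⟨C, hC⟩ := g.2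
    exact exists_isDominatedWithMass hK hint hC
  have hsub : ∀ c : ℝ, 0 < c → ∀ g : B, p (c • g) ≤ c * p g := by
    intro c hc g
    rw [← div_le_iff₀' hc]
    refine le_csInf (hne g) fun t ht => ?_
    rw [div_le_iff₀' hc]
    exact csInf_le (hbdd _) (ht.smul hc.le)
  have hone : (1 : EuclideanSpace ℝ (Fin n) → ℝ) ∈ B := ⟨1, fun y _ => by simp⟩
  have hone0 : (⟨1, hone⟩ : B) ≠ 0 := fun h => by
    have := congrFun (congrArg Subtype.val h) 0
    simp at this
  -- Hahn–Banach: the minimal dominating mass `p` is sublinear, and on the line spanned by `1` the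
  -- functional `c ↦ c M` lies below it by `le_of_isDominatedWithMass_const`.
  have hext := exists_extension_of_le_sublinear
    (LinearPMap.mkSpanSingleton (⟨1, hone⟩ : B) (M : ℝ) hone0) p ?_ ?_ ?_
  · obtain ⟨Λ, hΛ, hΛp⟩ := hext
    obtain ⟨Λ', hΛ'⟩ := Λ.exists_extend
    have hΛ'B : ∀ g : B, Λ' g = Λ g := fun g => by rw [← hΛ']; rfl
    refine ⟨Λ', ?_, fun g hg t ht => ?_⟩
    · rw [hΛ'B ⟨1, hone⟩]
      have := hΛ ⟨⟨1, hone⟩, Submodule.mem_span_singleton_self _⟩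
      exact this.trans (LinearPMap.mkSpanSingleton_apply ..)
    · rw [hΛ'B ⟨g, hg⟩]
      exact (hΛp _).trans (csInf_le (hbdd _) ht)
  · intro c hc g
    refine (hsub c hc g).antisymm ?_
    have := hsub c⁻¹ (inv_pos.2 hc) (c • g)
    rw [smul_smul, inv_mul_cancel₀ hc.ne', one_smul, ← div_eq_inv_mul, le_div_iff₀' hc] at this
    exact this
  · intro g h
    rw [← sub_le_iff_le_add]
    refine le_csInf (hne g) fun t ht => ?_
    rw [sub_le_iff_le_add, ← sub_le_iff_le_add']
    refine le_csInf (hne h) fun s hs => ?_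
    rw [sub_le_iff_le_add']
    exact csInf_le (hbdd _) (ht.add hKc h0K hs)
  · rintro ⟨g, hg⟩
    obtain ⟨c, rfl⟩ := Submodule.mem_span_singleton.1 hg
    refine le_csInf (hne _) fun t ht => ?_
    rw [LinearPMap.mkSpanSingleton'_apply]
    exact le_of_isDominatedWithMass_const hK hKc hint hM ht

end Duality

/-! ### Where the dual weight sits -/

section DualWeight

variable {n : ℕ} {K : Set (EuclideanSpace ℝ (Fin n))}
  {Λ : (EuclideanSpace ℝ (Fin n) → ℝ) →ₗ[ℝ] ℝ}

/-- A feasible solution of the linear program dual to fractional covering by smaller copies. -/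
def IsDualWeight (K : Set (EuclideanSpace ℝ (Fin n)))
    (Λ : (EuclideanSpace ℝ (Fin n) → ℝ) →ₗ[ℝ] ℝ) : Prop :=
  ∀ g, (∃ C, ∀ y ∈ K, |g y| ≤ C) → ∀ t, IsDominatedWithMass K g t → Λ g ≤ t

theorem abs_indicator_one_le (S : Set (EuclideanSpace ℝ (Fin n))) (y : EuclideanSpace ℝ (Fin n)) :
    |S.indicator (1 : EuclideanSpace ℝ (Fin n) → ℝ) y| ≤ 1 := by
  by_cases h : y ∈ S <;> simp [h]

/-- The zero measure dominates `g - h`. In particular `Λ` depends only on values on `K`. -/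
theorem IsDualWeight.mono (hΛ : IsDualWeight K Λ) {g h : EuclideanSpace ℝ (Fin n) → ℝ} {C D : ℝ}
    (hg : ∀ y ∈ K, |g y| ≤ C) (hh : ∀ y ∈ K, |h y| ≤ D) (hgh : ∀ y ∈ K, g y ≤ h y) :
    Λ g ≤ Λ h := by
  rw [← sub_nonpos, ← map_sub]
  refine hΛ _ ⟨C + D, fun y hy => (abs_sub _ _).trans (add_le_add (hg y hy) (hh y hy))⟩ 0 ?_
  exact ⟨0, inferInstance, by simp, 1 / 2, by norm_num, fun y hy => by simpa using hgh y hy⟩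

theorem IsDualWeight.indicator_le_one (hΛ : IsDualWeight K Λ)
    {S : Set (EuclideanSpace ℝ (Fin n))} {x : EuclideanSpace ℝ (Fin n)} {r : ℝ}
    (hr : r ∈ Set.Ioo (0 : ℝ) 1) (hS : S ⊆ x +ᵥ r • K) : Λ (S.indicator 1) ≤ 1 := by
  refine hΛ _ ⟨1, fun y _ => abs_indicator_one_le S y⟩ 1 ?_
  refine ⟨Measure.dirac x, inferInstance, by simp, r, hr, fun y _ => ?_⟩
  by_cases hy : y ∈ S
  · obtain ⟨k, hk, hkx⟩ := hS hy
    have hmem : x ∈ {x | y - x ∈ r • K} := by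
      have : y - x = k := by rw [← hkx]; simp
      rw [Set.mem_ofPred_eq, this]
      exact hk
    rw [Set.indicator_of_mem hy, measureReal_def, Measure.dirac_apply_of_mem hmem]
    simp
  · rw [Set.indicator_of_notMem hy]
    exact measureReal_nonneg

/-- Complementary slackness. By symmetry `y - rK ⊆ 2K` for `y ∈ K`, so Lebesgue measure on `2K \ A`
dominates `vol(rK) - vol(A ∩ (y - K))`. Comparing masses and letting `r → 1`, the terms `2^n vol K`
cancel. -/
theorem IsDualWeight.volume_le (hΛ : IsDualWeight K Λ) (hK : IsCompact K) (hKc : Convex ℝ K)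
    (h0 : 0 ∈ interior K) (hsymm : K = -K) (hΛ1 : Λ 1 = 2 ^ n)
    {A : Set (EuclideanSpace ℝ (Fin n))} (hA : MeasurableSet A) (hAK : A ⊆ (2 : ℝ) • K) :
    volume.real A ≤ Λ (fun y => volume.real (A ∩ {x | y - x ∈ K})) := by
  set G : EuclideanSpace ℝ (Fin n) → ℝ := fun y => volume.real (A ∩ {x | y - x ∈ K})
  have h0K := interior_subset h0
  have h2K : IsCompact ((2 : ℝ) • K) := hK.smul _
  have hAfin : volume A ≠ ∞ := ((measure_mono hAK).trans_lt h2K.measure_lt_top).ne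
  have hV : 0 < volume.real K :=
    ENNReal.toReal_pos (volume_ne_zero_of_interior_nonempty ⟨0, h0⟩) hK.measure_lt_top.ne
  have hG : ∀ y, |G y| ≤ volume.real A := fun y => by
    rw [abs_of_nonneg measureReal_nonneg]
    exact measureReal_mono Set.inter_subset_left hAfin
  have hreal : ∀ r : ℝ, 0 ≤ r → volume.real (r • K) = r ^ n * volume.real K := fun r hr => by
    rw [measureReal_def, Measure.addHaar_smul, finrank_euclideanSpace_fin,
      abs_of_nonneg (pow_nonneg hr _), ENNReal.toReal_mul,
      ENNReal.toReal_ofReal (pow_nonneg hr _), measureReal_def]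
  have key : ∀ r ∈ Set.Ioo (0 : ℝ) 1,
      r ^ n * volume.real K * 2 ^ n - Λ G ≤ 2 ^ n * volume.real K - volume.real A := by
    intro r hr
    set c : ℝ := r ^ n * volume.real K
    have hc : 0 < c := mul_pos (pow_pos hr.1 n) hV
    have hfin : IsFiniteMeasure ((volume : Measure (EuclideanSpace ℝ (Fin n))).restrict
        ((2 : ℝ) • K \ A)) :=
      ⟨by simpa using (measure_mono Set.sdiff_subset).trans_lt h2K.measure_lt_top⟩
    have hdom : IsDominatedWithMass K (1 - c⁻¹ • G)
        (c⁻¹ * (2 ^ n * volume.real K - volume.real A)) := by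
      refine ⟨c⁻¹.toNNReal • volume.restrict ((2 : ℝ) • K \ A), inferInstance, ?_, r, hr, ?_⟩
      · rw [measureReal_nnreal_smul_apply, Real.coe_toNNReal _ (inv_pos.2 hc).le,
          measureReal_restrict_apply_univ, measureReal_sdiff hAK hA h2K.measure_lt_top.ne, hreal 2 zero_le_two]
      · intro y hy
        have hsub : {x | y - x ∈ r • K} ⊆ (2 : ℝ) • K := by
          intro x hx
          obtain ⟨k, hk, hkx⟩ := smul_subset_smul_of_le hKc h0K hr.1 hr.2.le hx
          replace hkx : k = y - x := (one_smul ℝ k).symm.trans hkx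
          have hx' : x = y + -k := by rw [hkx]; abel
          have hk' : -k ∈ K := by rw [hsymm]; simpa using hk
          rw [hx']
          refine ⟨(1 / 2 : ℝ) • y + (1 / 2 : ℝ) • (-k),
            hKc hy hk' (by norm_num) (by norm_num) (by norm_num), ?_⟩
          simp [smul_smul]
        have hmeas : MeasurableSet {x | y - x ∈ r • K} :=
          ((hK.smul r).isClosed.preimage (continuous_const.sub continuous_id)).measurableSet
        have hvol : volume.real {x | y - x ∈ r • K} = c := by
          rw [measureReal_def, measure_reflect, ← measureReal_def, hreal r hr.1.le]
        have hle : c - G y ≤ volume.real ({x | y - x ∈ r • K} ∩ ((2 : ℝ) • K \ A)) := by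
          have h1 : {x | y - x ∈ r • K} ⊆ ({x | y - x ∈ r • K} ∩ ((2 : ℝ) • K \ A)) ∪
              (A ∩ {x | y - x ∈ K}) := by
            intro x hx
            by_cases hxA : x ∈ A
            · right
              have := smul_subset_smul_of_le hKc h0K hr.1 hr.2.le hx
              rw [one_smul] at this
              exact ⟨hxA, this⟩
            · exact Or.inl ⟨hx, hsub hx, hxA⟩
          have hf1 : volume ({x | y - x ∈ r • K} ∩ ((2 : ℝ) • K \ A)) ≠ ∞ :=
            ((measure_mono fun x hx => hx.2.1).trans_lt h2K.measure_lt_top).ne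
          have hf2 : volume (A ∩ {x | y - x ∈ K}) ≠ ∞ :=
            ((measure_mono Set.inter_subset_left).trans_lt hAfin.lt_top).ne
          have h2 := measureReal_mono h1 (measure_union_ne_top hf1 hf2)
          have h3 := measureReal_union_le (μ := volume)
            ({x | y - x ∈ r • K} ∩ ((2 : ℝ) • K \ A)) (A ∩ {x | y - x ∈ K})
          rw [hvol] at h2
          change c - volume.real (A ∩ {x | y - x ∈ K}) ≤ _
          linarith
        rw [measureReal_nnreal_smul_apply, Real.coe_toNNReal _ (inv_pos.2 hc).le,
          measureReal_restrict_apply hmeas]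
        calc (1 - c⁻¹ • G) y = c⁻¹ * (c - G y) := by
              simp only [Pi.sub_apply, Pi.one_apply, Pi.smul_apply, smul_eq_mul]
              field_simp
          _ ≤ _ := mul_le_mul_of_nonneg_left hle (inv_pos.2 hc).le
    have hb : ∃ C, ∀ y ∈ K, |(1 - c⁻¹ • G) y| ≤ C := by
      refine ⟨1 + |c⁻¹| * volume.real A, fun y _ => (abs_sub _ _).trans ?_⟩
      refine add_le_add (by simp) ?_
      rw [Pi.smul_apply, smul_eq_mul, abs_mul]
      exact mul_le_mul_of_nonneg_left (hG y) (abs_nonneg _)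
    have h1 := hΛ _ hb _ hdom
    rw [map_sub, map_smul, hΛ1, smul_eq_mul] at h1
    have h2 := mul_le_mul_of_nonneg_left h1 hc.le
    rw [mul_sub, ← mul_assoc, ← mul_assoc, mul_inv_cancel₀ hc.ne', one_mul, one_mul] at h2
    exact h2
  have hlim : Filter.Tendsto (fun r : ℝ => r ^ n * volume.real K * 2 ^ n - Λ G) (𝓝[<] 1)
      (𝓝 (1 ^ n * volume.real K * 2 ^ n - Λ G)) := by
    refine Filter.Tendsto.mono_left ?_ nhdsWithin_le_nhds
    have : Continuous (fun r : ℝ => r ^ n * volume.real K * 2 ^ n - Λ G) := by fun_prop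
    exact this.tendsto 1
  have := le_of_tendsto hlim (by
    filter_upwards [Ioo_mem_nhdsLT (show (0 : ℝ) < 1 by norm_num)] with r hr using key r hr)
  rw [one_pow] at this
  linarith

theorem IsDualWeight.one_le_of_mem_extremePoints (hΛ : IsDualWeight K Λ) (hK : IsCompact K)
    (hKc : Convex ℝ K) (h0 : 0 ∈ interior K) (hsymm : K = -K) (hΛ1 : Λ 1 = 2 ^ n)
    {v : EuclideanSpace ℝ (Fin n)} (hv : v ∈ Set.extremePoints ℝ K)
    {U : Set (EuclideanSpace ℝ (Fin n))} (hU : IsOpen U) (hvU : v ∈ U) :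
    1 ≤ Λ (U.indicator 1) := by
  -- By extremality, `2v = y + z` with `y, z ∈ K` forces `y = v`, so `2v` avoids the closed set `C`.
  -- For `x` in `2K` outside `C`, all points of `K ∩ (x + K)` lie in `U`.
  set C : Set (EuclideanSpace ℝ (Fin n)) := (K \ U) + K
  have hC : IsClosed C := ((hK.diff hU).add hK).isClosed
  have hvC : (2 : ℝ) • v ∉ C := by
    rintro ⟨y, hy, z, hz, hyz⟩
    have hyz' : y + z = (2 : ℝ) • v := hyz
    have hmem : v ∈ openSegment ℝ y z := by
      refine ⟨1 / 2, 1 / 2, by norm_num, by norm_num, by norm_num, ?_⟩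
      rw [← smul_add, hyz', smul_smul]
      norm_num
    exact hy.2 ((hv.2 hy.1 hz hmem) ▸ hvU)
  set A : Set (EuclideanSpace ℝ (Fin n)) := (2 : ℝ) • K ∩ Cᶜ
  have hA : MeasurableSet A := (hK.smul (2 : ℝ)).isClosed.measurableSet.inter
    hC.isOpen_compl.measurableSet
  have hAfin : volume A ≠ ∞ :=
    ((measure_mono Set.inter_subset_left).trans_lt (hK.smul (2 : ℝ)).measure_lt_top).ne
  have hApos : volume A ≠ 0 := by
    have h2v : (2 : ℝ) • v ∈ closure (interior ((2 : ℝ) • K)) := by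
      rw [(hKc.smul 2).closure_interior_eq_closure_of_nonempty_interior]
      · exact subset_closure (Set.smul_mem_smul_set hv.1)
      · rw [interior_smul₀ two_ne_zero]
        exact ⟨_, Set.smul_mem_smul_set h0⟩
    obtain ⟨z, hz1, hz2⟩ := mem_closure_iff.1 h2v _ hC.isOpen_compl hvC
    refine ((isOpen_interior.inter hC.isOpen_compl).measure_pos volume ⟨z, hz2, hz1⟩).trans_le
      (measure_mono (Set.inter_subset_inter_left _ interior_subset)) |>.ne'
  have hVA : 0 < volume.real A := ENNReal.toReal_pos hApos hAfin
  have h1 := hΛ.volume_le hK hKc h0 hsymm hΛ1 hA Set.inter_subset_left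
  have h2 : Λ (fun y => volume.real (A ∩ {x | y - x ∈ K})) ≤
      Λ (volume.real A • U.indicator 1) := by
    refine hΛ.mono (C := volume.real A) (D := volume.real A) (fun y _ => ?_) (fun y _ => ?_)
      fun y hy => ?_
    · rw [abs_of_nonneg measureReal_nonneg]
      exact measureReal_mono Set.inter_subset_left hAfin
    · rw [Pi.smul_apply, smul_eq_mul, abs_mul, abs_of_pos hVA]
      exact mul_le_of_le_one_right hVA.le (abs_indicator_one_le U y)
    · by_cases hyU : y ∈ U
      · rw [Pi.smul_apply, Set.indicator_of_mem hyU]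
        simpa using measureReal_mono Set.inter_subset_left hAfin
      · have : A ∩ {x | y - x ∈ K} = ∅ := by
          rw [Set.eq_empty_iff_forall_notMem]
          rintro x ⟨hxA, hx⟩
          refine hxA.2 ⟨y, ⟨hy, hyU⟩, x - y, ?_, by simp⟩
          rw [hsymm]
          simpa using hx
        simp [this, hyU]
  rw [map_smul, smul_eq_mul] at h2
  exact le_of_mul_le_mul_left (by linarith) hVA

theorem exists_smul_of_mem_interior {z : EuclideanSpace ℝ (Fin n)} (hz : z ∈ interior K) :
    ∃ r ∈ Set.Ioo (0 : ℝ) 1, z ∈ r • interior K := by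
  have hlim : Filter.Tendsto (fun r : ℝ => r⁻¹ • z) (𝓝[<] 1) (𝓝 z) := by
    refine Filter.Tendsto.mono_left ?_ nhdsWithin_le_nhds
    have : Filter.Tendsto (fun r : ℝ => r⁻¹ • z) (𝓝 1) (𝓝 ((1 : ℝ)⁻¹ • z)) :=
      (tendsto_inv₀ one_ne_zero).smul_const z
    simpa using this
  have h01 : ∀ᶠ r in 𝓝[<] (1 : ℝ), r ∈ Set.Ioo (0 : ℝ) 1 := Ioo_mem_nhdsLT zero_lt_one
  obtain ⟨r, hr, hrz⟩ := (h01.and (hlim.eventually (isOpen_interior.mem_nhds hz))).exists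
  exact ⟨r, hr, (Set.mem_smul_set_iff_inv_smul_mem₀ hr.1.ne' _ _).2 hrz⟩

/-- Two points whose difference lies in the interior of `2 • K` have disjoint neighbourhoods of
total weight at most one. -/
theorem IsDualWeight.exists_nhds_add_le_one (hΛ : IsDualWeight K Λ) (hsymm : K = -K)
    {y v : EuclideanSpace ℝ (Fin n)} (hyv : y ≠ v) (h : (1 / 2 : ℝ) • (y - v) ∈ interior K) :
    ∃ U W : Set (EuclideanSpace ℝ (Fin n)), IsOpen U ∧ IsOpen W ∧ y ∈ U ∧ v ∈ W ∧
      Λ (U.indicator 1) + Λ (W.indicator 1) ≤ 1 := by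
  obtain ⟨r, hr, hz⟩ := exists_smul_of_mem_interior h
  have hisymm : interior K = -interior K := by
    conv_lhs => rw [hsymm]
    exact ((Homeomorph.neg _).preimage_interior K).symm
  -- A smaller copy centred at the midpoint contains both points, since they sit at `±(y - v)/2`
  -- from it.
  set O : Set (EuclideanSpace ℝ (Fin n)) := ((1 / 2 : ℝ) • (y + v)) +ᵥ r • interior K
  have hO : IsOpen O := (isOpen_interior.smul₀ hr.1.ne').vadd _
  have hyO : y ∈ O := ⟨_, hz, by simp only [vadd_eq_add]; module⟩
  have hvO : v ∈ O := by
    refine ⟨-((1 / 2 : ℝ) • (y - v)), ?_, by simp only [vadd_eq_add]; module⟩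
    rw [hisymm, Set.smul_set_neg, Set.neg_mem_neg]
    exact hz
  obtain ⟨U, W, hU, hW, hyU, hvW, hdisj⟩ := t2_separation hyv
  refine ⟨U ∩ O, W ∩ O, hU.inter hO, hW.inter hO, ⟨hyU, hyO⟩, ⟨hvW, hvO⟩, ?_⟩
  have hadd := Set.indicator_union_of_disjoint
    (hdisj.mono (Set.inter_subset_left (t := O)) (Set.inter_subset_left (t := O)))
    (1 : EuclideanSpace ℝ (Fin n) → ℝ)
  rw [← map_add]
  refine (congrArg Λ hadd).symm.trans_le ?_
  have hsub : U ∩ O ∪ W ∩ O ⊆ ((1 / 2 : ℝ) • (y + v)) +ᵥ r • K :=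
    (Set.union_subset Set.inter_subset_right Set.inter_subset_right).trans
      (Set.vadd_set_mono (Set.smul_set_mono interior_subset))
  exact hΛ.indicator_le_one hr hsub

end DualWeight

/-! ### Counting extreme points -/

section Vertices

variable {n : ℕ} {K : Set (EuclideanSpace ℝ (Fin n))}

theorem add_mem_two_smul (hKc : Convex ℝ K) {a b : EuclideanSpace ℝ (Fin n)} (ha : a ∈ K)
    (hb : b ∈ K) : a + b ∈ (2 : ℝ) • K := by
  refine ⟨(1 / 2 : ℝ) • a + (1 / 2 : ℝ) • b, hKc ha hb (by norm_num) (by norm_num) (by norm_num), ?_⟩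
  simp [smul_smul]

theorem volume_interior_eq (hKc : Convex ℝ K) :
    volume (interior K) = volume K :=
  le_antisymm (measure_mono interior_subset) (by
    calc volume K ≤ volume (interior K ∪ frontier K) :=
          measure_mono (by rw [← closure_eq_interior_union_frontier]; exact subset_closure)
      _ ≤ volume (interior K) + volume (frontier K) := measure_union_le _ _
      _ = volume (interior K) := by rw [hKc.addHaar_frontier volume, add_zero])

/-- A finite set of points of `K` with pairwise differences outside the interior of `2 • K` gives
disjoint translates of the interior of `K`. -/
theorem pairwiseDisjoint_vadd_interior (hKc : Convex ℝ K) (hsymm : K = -K)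
    {V : Set (EuclideanSpace ℝ (Fin n))}
    (hV : ∀ v ∈ V, ∀ w ∈ V, v ≠ w → (1 / 2 : ℝ) • (v - w) ∉ interior K) :
    V.PairwiseDisjoint fun v => v +ᵥ interior K := by
  have hisymm : interior K = -interior K := by
    conv_lhs => rw [hsymm]
    exact ((Homeomorph.neg _).preimage_interior K).symm
  intro v hv w hw hvw
  rw [Function.onFun, Set.disjoint_left]
  rintro _ ⟨a, ha, rfl⟩ ⟨b, hb, hab⟩
  refine hV v hv w hw hvw ?_
  have ha' : -a ∈ interior K := by rw [hisymm]; simpa using ha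
  have := hKc.interior hb ha' (show (0 : ℝ) ≤ 1 / 2 by norm_num) (show (0 : ℝ) ≤ 1 / 2 by norm_num)
    (by norm_num)
  convert this using 1
  simp only [vadd_eq_add] at hab
  rw [← smul_add]
  congr 1
  rw [sub_eq_iff_eq_add, add_right_comm, add_comm b w, hab]
  abel

theorem volume_biUnion_vadd_interior (hKc : Convex ℝ K) (hsymm : K = -K)
    {V : Finset (EuclideanSpace ℝ (Fin n))}
    (hV : ∀ v ∈ V, ∀ w ∈ V, v ≠ w → (1 / 2 : ℝ) • (v - w) ∉ interior K) :
    volume (⋃ v ∈ V, v +ᵥ interior K) = V.card * volume K := by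
  rw [measure_biUnion_finset (pairwiseDisjoint_vadd_interior hKc hsymm hV)
    fun v _ => (isOpen_interior.vadd v).measurableSet]
  simp [measure_vadd, volume_interior_eq hKc]

theorem biUnion_vadd_interior_subset (hKc : Convex ℝ K) {V : Set (EuclideanSpace ℝ (Fin n))}
    (hVK : V ⊆ K) : (⋃ v ∈ V, v +ᵥ interior K) ⊆ (2 : ℝ) • K := by
  refine Set.iUnion₂_subset fun v hv => ?_
  rintro _ ⟨k, hk, rfl⟩
  exact add_mem_two_smul hKc (hVK hv) (interior_subset hk)

theorem volume_two_smul (K : Set (EuclideanSpace ℝ (Fin n))) :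
    volume ((2 : ℝ) • K) = 2 ^ n * volume K := by
  rw [Measure.addHaar_smul, finrank_euclideanSpace_fin, abs_of_nonneg (by positivity),
    ENNReal.ofReal_pow zero_le_two]
  simp

theorem card_le_two_pow (hK : IsCompact K) (hKc : Convex ℝ K) (hint : (interior K).Nonempty)
    (hsymm : K = -K) {V : Finset (EuclideanSpace ℝ (Fin n))} (hVK : ↑V ⊆ K)
    (hV : ∀ v ∈ V, ∀ w ∈ V, v ≠ w → (1 / 2 : ℝ) • (v - w) ∉ interior K) : V.card ≤ 2 ^ n := by
  have h1 := measure_mono (μ := volume) (biUnion_vadd_interior_subset hKc hVK)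
  simp only [Finset.mem_coe] at h1
  rw [volume_biUnion_vadd_interior hKc hsymm hV, volume_two_smul,
    ENNReal.mul_le_mul_iff_left (volume_ne_zero_of_interior_nonempty hint)
      hK.measure_lt_top.ne] at h1
  exact_mod_cast h1

/-- Choose `v` with positive weight in a convex combination for `y`. In the resulting expansion of
`(y - v)/2` the `v`-term vanishes, so it may be replaced by `w v • k` for any `k ∈ K`; this fits a
small copy of `K` around `(y - v)/2` inside `K`. -/
theorem exists_vertex_half_sub_mem_interior (hKc : Convex ℝ K) (h0 : 0 ∈ interior K)
    (hsymm : K = -K) {V : Finset (EuclideanSpace ℝ (Fin n))} (hVK : ↑V ⊆ K)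
    {y : EuclideanSpace ℝ (Fin n)} (hy : y ∈ convexHull ℝ (V : Set (EuclideanSpace ℝ (Fin n)))) :
    ∃ v ∈ V, (1 / 2 : ℝ) • (y - v) ∈ interior K := by
  classical
  obtain ⟨w, hw0, hw1, hwy⟩ := Finset.mem_convexHull'.1 hy
  obtain ⟨v, hv, hwv⟩ : ∃ v ∈ V, 0 < w v := by
    by_contra! h
    have : ∑ v ∈ V, w v ≤ 0 := Finset.sum_nonpos h
    linarith
  refine ⟨v, hv, ?_⟩
  have hmem : ∀ k ∈ K, (1 / 2 : ℝ) • (y - v) + w v • k ∈ K := by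
    intro k hk
    have hz : ∀ u ∈ V, (if u = v then k else (1 / 2 : ℝ) • (u - v)) ∈ K := by
      intro u hu
      split_ifs
      · exact hk
      · have hv' : -v ∈ K := by rw [hsymm]; simpa using hVK hv
        have := hKc (hVK hu) hv' (show (0 : ℝ) ≤ 1 / 2 by norm_num)
          (show (0 : ℝ) ≤ 1 / 2 by norm_num) (by norm_num)
        rwa [← smul_add, ← sub_eq_add_neg] at this
    have := hKc.sum_mem hw0 hw1 hz
    convert this using 1
    have h1 : (1 / 2 : ℝ) • (y - v) = ∑ u ∈ V, w u • ((1 / 2 : ℝ) • (u - v)) := by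
      have : ∑ u ∈ V, w u • ((1 / 2 : ℝ) • (u - v)) =
          (1 / 2 : ℝ) • (∑ u ∈ V, w u • u - (∑ u ∈ V, w u) • v) := by
        rw [Finset.sum_smul, ← Finset.sum_sub_distrib, Finset.smul_sum]
        refine Finset.sum_congr rfl fun u _ => ?_
        module
      rw [this, hwy, hw1, one_smul]
    have h2 : w v • k = ∑ u ∈ V, if u = v then w v • k else 0 := by simp [hv]
    rw [h1, h2, ← Finset.sum_add_distrib]
    refine Finset.sum_congr rfl fun u _ => ?_
    by_cases huv : u = v <;> simp [huv]
  have hopen : IsOpen ((1 / 2 : ℝ) • (y - v) +ᵥ w v • interior K) :=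
    (isOpen_interior.smul₀ hwv.ne').vadd _
  refine interior_maximal ?_ hopen ⟨0, ⟨0, h0, smul_zero _⟩, by simp⟩
  rintro _ ⟨_, ⟨k, hk, rfl⟩, rfl⟩
  exact hmem k (interior_subset hk)

/-- If the dual linear program has value `2 ^ n`, then `K` has exactly `2 ^ n` extreme points, and
their differences lie outside the interior of `2 • K`. -/
theorem exists_finset_extremePoints {Λ : (EuclideanSpace ℝ (Fin n) → ℝ) →ₗ[ℝ] ℝ}
    (hΛ : IsDualWeight K Λ) (hK : IsCompact K) (hKc : Convex ℝ K) (h0 : 0 ∈ interior K)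
    (hsymm : K = -K) (hΛ1 : Λ 1 = 2 ^ n) :
    ∃ V : Finset (EuclideanSpace ℝ (Fin n)),
      (V : Set (EuclideanSpace ℝ (Fin n))) = Set.extremePoints ℝ K ∧
      K = convexHull ℝ (V : Set (EuclideanSpace ℝ (Fin n))) ∧ V.card = 2 ^ n ∧
      ∀ v ∈ V, ∀ w ∈ V, v ≠ w → (1 / 2 : ℝ) • (v - w) ∉ interior K := by
  classical
  have hone : ∀ v ∈ Set.extremePoints ℝ K, ∀ U, IsOpen U → v ∈ U → 1 ≤ Λ (U.indicator 1) :=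
    fun v hv U hU hvU => hΛ.one_le_of_mem_extremePoints hK hKc h0 hsymm hΛ1 hv hU hvU
  have hpack : ∀ v ∈ Set.extremePoints ℝ K, ∀ w ∈ Set.extremePoints ℝ K, v ≠ w →
      (1 / 2 : ℝ) • (v - w) ∉ interior K := by
    intro v hv w hw hvw h
    obtain ⟨U, W, hU, hW, hvU, hwW, hle⟩ := hΛ.exists_nhds_add_le_one hsymm hvw h
    linarith [hone v hv U hU hvU, hone w hw W hW hwW]
  have hfin : (Set.extremePoints ℝ K).Finite := by
    by_contra hinf
    obtain ⟨t, ht, hcard⟩ := Set.Infinite.exists_subset_card_eq hinf (2 ^ n + 1)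
    have := card_le_two_pow hK hKc ⟨0, h0⟩ hsymm (ht.trans extremePoints_subset)
      fun v hv w hw => hpack v (ht hv) w (ht hw)
    omega
  obtain ⟨V, hVext⟩ := hfin.exists_finset_coe
  have hVK : (V : Set (EuclideanSpace ℝ (Fin n))) ⊆ K := hVext ▸ extremePoints_subset
  have hpackV : ∀ v ∈ V, ∀ w ∈ V, v ≠ w → (1 / 2 : ℝ) • (v - w) ∉ interior K := fun v hv w hw =>
    hpack v (hVext ▸ Finset.mem_coe.2 hv) w (hVext ▸ Finset.mem_coe.2 hw)
  have hKV : K = convexHull ℝ (V : Set (EuclideanSpace ℝ (Fin n))) := by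
    have := closure_convexHull_extremePoints hK hKc
    rwa [← hVext, (V.finite_toSet.isCompact_convexHull (𝕜 := ℝ)).isClosed.closure_eq, eq_comm]
      at this
  refine ⟨V, hVext, hKV, (card_le_two_pow hK hKc ⟨0, h0⟩ hsymm hVK hpackV).antisymm ?_, hpackV⟩
  -- A half-size copy around a vertex weighs at most 1. A non-vertex shares a total of 1 with a
  -- vertex that already uses all of it. A finite subcover then gives `Λ 1 ≤ V.card`.
  have hnhds : ∀ y ∈ K, ∃ U ∈ 𝓝 y, Λ (U.indicator 1) ≤ if y ∈ V then 1 else 0 := by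
    intro y hy
    by_cases hyV : y ∈ V
    · have hmem : (0 : EuclideanSpace ℝ (Fin n)) ∈ (1 / 2 : ℝ) • interior K :=
        ⟨0, h0, smul_zero _⟩
      refine ⟨y +ᵥ (1 / 2 : ℝ) • interior K,
        ((isOpen_interior.smul₀ (by norm_num)).vadd y).mem_nhds ⟨0, hmem, by simp⟩, ?_⟩
      rw [if_pos hyV]
      exact hΛ.indicator_le_one (r := 1 / 2) (by norm_num)
        (Set.vadd_set_mono (Set.smul_set_mono interior_subset))
    · obtain ⟨v, hv, hyv⟩ := exists_vertex_half_sub_mem_interior hKc h0 hsymm hVK (hKV ▸ hy)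
      have hne : y ≠ v := fun h => hyV (h ▸ hv)
      obtain ⟨U, W, hU, hW, hyU, hvW, hle⟩ := hΛ.exists_nhds_add_le_one hsymm hne hyv
      refine ⟨U, hU.mem_nhds hyU, ?_⟩
      rw [if_neg hyV]
      linarith [hone v (hVext ▸ Finset.mem_coe.2 hv) W hW hvW]
  choose! U hU hUle using hnhds
  obtain ⟨t, htK, hcov⟩ := hK.elim_nhds_subcover U hU
  have hsum : Λ 1 ≤ Λ (∑ y ∈ t, (U y).indicator 1) := by
    refine hΛ.mono (C := 1) (D := ∑ y ∈ t, 1) (by simp) (fun z _ => ?_) fun z hz => ?_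
    · rw [Finset.sum_apply]
      exact (Finset.abs_sum_le_sum_abs _ _).trans
        (Finset.sum_le_sum fun y _ => abs_indicator_one_le _ _)
    · obtain ⟨y, hy, hzy⟩ := Set.mem_iUnion₂.1 (hcov hz)
      rw [Finset.sum_apply, Pi.one_apply]
      have : (U y).indicator (1 : EuclideanSpace ℝ (Fin n) → ℝ) z = 1 := by simp [hzy]
      rw [← this]
      exact Finset.single_le_sum (f := fun y => (U y).indicator (1 : EuclideanSpace ℝ (Fin n) → ℝ) z)
        (fun y _ => Set.indicator_nonneg (fun _ _ => zero_le_one) _) hy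
  have hcard : (2 : ℝ) ^ n ≤ V.card := by
    rw [← hΛ1]
    refine hsum.trans ?_
    rw [map_sum]
    calc ∑ y ∈ t, Λ ((U y).indicator 1) ≤ ∑ y ∈ t, (if y ∈ V then (1 : ℝ) else 0) :=
          Finset.sum_le_sum fun y hy => hUle y (htK y hy)
      _ = ((t.filter (· ∈ V)).card : ℝ) := by
        simp [Finset.filter_mem_eq_inter]
      _ ≤ V.card := by
        exact_mod_cast Finset.card_le_card fun y hy => (Finset.mem_filter.1 hy).2
  exact_mod_cast hcard

end Vertices

/-! ### Caps, and the number of vertices on a facet -/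

section Facets

open scoped RealInnerProductSpace

variable {n : ℕ} {K : Set (EuclideanSpace ℝ (Fin n))} {V : Finset (EuclideanSpace ℝ (Fin n))}
  {u : EuclideanSpace ℝ (Fin n)}

theorem volume_two_smul_diff_eq_zero (hK : IsCompact K) (hKc : Convex ℝ K) (hsymm : K = -K)
    (hVK : (V : Set (EuclideanSpace ℝ (Fin n))) ⊆ K) (hcard : V.card = 2 ^ n)
    (hV : ∀ v ∈ V, ∀ w ∈ V, v ≠ w → (1 / 2 : ℝ) • (v - w) ∉ interior K) :
    volume ((2 : ℝ) • K \ ⋃ v ∈ V, v +ᵥ interior K) = 0 := by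
  have hsub : (⋃ v ∈ V, v +ᵥ interior K) ⊆ (2 : ℝ) • K := by
    have := biUnion_vadd_interior_subset hKc hVK
    simpa only [Finset.mem_coe] using this
  have hvol := volume_biUnion_vadd_interior hKc hsymm hV
  have hfin : volume (⋃ v ∈ V, v +ᵥ interior K) ≠ ∞ :=
    ((measure_mono hsub).trans_lt (hK.smul (2 : ℝ)).measure_lt_top).ne
  rw [measure_sdiff hsub
    (isOpen_biUnion fun v _ => isOpen_interior.vadd v).nullMeasurableSet hfin,
    hvol, volume_two_smul, hcard]
  simp

/-- Self-similarity of the caps of a body `K` such that `2 • K` is tiled by translates of `K`. -/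
theorem two_pow_mul_volume_cap_le
    (htile : volume ((2 : ℝ) • K \ ⋃ v ∈ V, v +ᵥ interior K) = 0) (hu : ∀ x ∈ K, ⟪u, x⟫ ≤ 1)
    {ε : ℝ} (hε : ∀ v ∈ V, ⟪u, v⟫ = 1 ∨ ⟪u, v⟫ ≤ 1 - ε) :
    2 ^ n * volume {x | x ∈ K ∧ 1 - ε / 2 < ⟪u, x⟫} ≤
      (V.filter fun v => ⟪u, v⟫ = 1).card * volume {x | x ∈ K ∧ 1 - ε < ⟪u, x⟫} := by
  rw [← volume_two_smul]
  have hsub : (2 : ℝ) • {x | x ∈ K ∧ 1 - ε / 2 < ⟪u, x⟫} ⊆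
      ((2 : ℝ) • K \ ⋃ v ∈ V, v +ᵥ interior K) ∪
        ⋃ v ∈ V.filter fun v => ⟪u, v⟫ = 1, v +ᵥ {x | x ∈ K ∧ 1 - ε < ⟪u, x⟫} := by
    rintro _ ⟨x, ⟨hxK, hx⟩, rfl⟩
    by_cases hmem : (2 : ℝ) • x ∈ ⋃ v ∈ V, v +ᵥ interior K
    · right
      obtain ⟨v, hv, k, hk, hkx⟩ := Set.mem_iUnion₂.1 hmem
      have hkx' : v + k = (2 : ℝ) • x := hkx
      have hin : ⟪u, v⟫ + ⟪u, k⟫ = 2 * ⟪u, x⟫ := by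
        rw [← inner_add_right, hkx', inner_smul_right]
      have hk1 := hu k (interior_subset hk)
      -- The two inner products sum to more than `2 - ε` and neither exceeds 1, so both exceed `1 -
      -- ε`; `hε` leaves only the value 1 for `v`.
      have hv1 : ⟪u, v⟫ = 1 := by
        rcases hε v hv with h | h
        · exact h
        · linarith
      refine Set.mem_iUnion₂.2 ⟨v, Finset.mem_filter.2 ⟨hv, hv1⟩, k,
        ⟨interior_subset hk, ?_⟩, hkx⟩
      linarith
    · exact Or.inl ⟨Set.smul_mem_smul_set hxK, hmem⟩
  refine (measure_mono hsub).trans ((measure_union_le _ _).trans ?_)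
  rw [htile, zero_add]
  refine (measure_biUnion_finset_le _ _).trans ?_
  simp [measure_vadd]

/-- In the cone `S` over the face, whatever misses the cap lies in `(1-δ) S`. The cap thus has
volume at least `(1 - (1-δ)^n) vol S`, and `(1-δ)^n ≤ 1-δ`. -/
theorem mul_volume_le_volume_cap (hn : 1 ≤ n) (hK : IsCompact K) (hKc : Convex ℝ K)
    (h0 : 0 ∈ K) {W : Set (EuclideanSpace ℝ (Fin n))} (hWK : W ⊆ K) (hWne : W.Nonempty)
    (hW : ∀ v ∈ W, ⟪u, v⟫ = 1) {δ : ℝ} (hδ : 0 < δ) (hδ1 : δ < 1) :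
    δ * volume.real (convexHull ℝ (insert 0 W)) ≤ volume.real {x | x ∈ K ∧ 1 - δ < ⟪u, x⟫} := by
  set S := convexHull ℝ (insert 0 W)
  have hSK : S ⊆ K := convexHull_min (Set.insert_subset h0 hWK) hKc
  have hS : Convex ℝ S := convex_convexHull ℝ _
  have h0S : (0 : EuclideanSpace ℝ (Fin n)) ∈ S :=
    subset_convexHull ℝ _ (Set.mem_insert _ _)
  have hδ' : 0 < 1 - δ := by linarith
  have hcap : volume {x | x ∈ K ∧ 1 - δ < ⟪u, x⟫} ≠ ∞ :=
    ((measure_mono fun x hx => hx.1).trans_lt hK.measure_lt_top).ne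
  have hSfin : volume S ≠ ∞ := ((measure_mono hSK).trans_lt hK.measure_lt_top).ne
  have hrS : volume.real ((1 - δ) • S) = (1 - δ) ^ n * volume.real S := by
    rw [measureReal_def, Measure.addHaar_smul, finrank_euclideanSpace_fin,
      abs_of_nonneg (pow_nonneg hδ'.le _), ENNReal.toReal_mul,
      ENNReal.toReal_ofReal (pow_nonneg hδ'.le _), measureReal_def]
  have hrSfin : volume ((1 - δ) • S) ≠ ∞ := by
    rw [Measure.addHaar_smul]
    exact ENNReal.mul_ne_top ENNReal.ofReal_ne_top hSfin
  have hsub : S ⊆ (1 - δ) • S ∪ {x | x ∈ K ∧ 1 - δ < ⟪u, x⟫} := by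
    intro x hx
    by_cases hxu : 1 - δ < ⟪u, x⟫
    · exact Or.inr ⟨hSK hx, hxu⟩
    left
    have hx' := hx
    rw [show S = convexJoin ℝ {0} (convexHull ℝ W) from convexHull_insert hWne,
      mem_convexJoin] at hx'
    obtain ⟨_, rfl, y, hy, a, t, ha, ht, hat, hxy⟩ := hx'
    rw [smul_zero, zero_add] at hxy
    have hyu : ⟪u, y⟫ = 1 := by
      have hconv : Convex ℝ {z : EuclideanSpace ℝ (Fin n) | ⟪u, z⟫ = 1} :=
        convex_hyperplane (innerSL ℝ u).isBoundedLinearMap.toIsLinearMap 1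
      exact convexHull_min (fun v hv => hW v hv) hconv hy
    have hyS : y ∈ S := convexHull_mono (Set.subset_insert _ _) hy
    rw [← hxy, inner_smul_right, hyu, mul_one, not_lt] at hxu
    refine ⟨(t / (1 - δ)) • y, hS.smul_mem_of_zero_mem h0S hyS
      ⟨by positivity, (div_le_one hδ').2 hxu⟩, ?_⟩
    simp only [smul_smul, mul_div_cancel₀ _ hδ'.ne']
    exact hxy
  have h1 := (measureReal_mono hsub (measure_union_ne_top hrSfin hcap)).trans
    (measureReal_union_le _ _)
  rw [hrS] at h1
  have h2 : (1 - δ) ^ n ≤ 1 - δ := pow_le_of_le_one hδ'.le (by linarith) (by omega)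
  have h3 := mul_le_mul_of_nonneg_right h2 (measureReal_nonneg (μ := volume) (s := S))
  linarith

/-- After `j` halvings the cap volume is at most a constant times `(c/2^n)^j`, but at least a
positive constant times `2^(-j)`: the spanning hypothesis makes the cone over the active vertices
full-dimensional. So `c/2^n ≥ 1/2`. -/
theorem two_pow_le_two_mul_card_active (hn : 1 ≤ n) (hK : IsCompact K) (hKc : Convex ℝ K)
    (h0 : 0 ∈ K) (hVK : (V : Set (EuclideanSpace ℝ (Fin n))) ⊆ K)
    (htile : volume ((2 : ℝ) • K \ ⋃ v ∈ V, v +ᵥ interior K) = 0) (hu : ∀ x ∈ K, ⟪u, x⟫ ≤ 1)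
    (hspan : Submodule.span ℝ {v | v ∈ V ∧ ⟪u, v⟫ = 1} = ⊤) :
    2 ^ n ≤ 2 * (V.filter fun v => ⟪u, v⟫ = 1).card := by
  have : Nonempty (Fin n) := ⟨⟨0, hn⟩⟩
  set W : Set (EuclideanSpace ℝ (Fin n)) := {v | v ∈ V ∧ ⟪u, v⟫ = 1}
  have hWne : W.Nonempty := by
    by_contra h
    rw [Set.not_nonempty_iff_eq_empty] at h
    rw [h, Submodule.span_empty] at hspan
    exact bot_ne_top hspan
  have hs : 0 < volume.real (convexHull ℝ (insert 0 W)) := by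
    have hfin : volume (convexHull ℝ (insert 0 W)) ≠ ∞ :=
      ((measure_mono (convexHull_min (Set.insert_subset h0 fun v hv => hVK hv.1) hKc)).trans_lt
        hK.measure_lt_top).ne
    refine ENNReal.toReal_pos (volume_ne_zero_of_interior_nonempty ?_) hfin
    rw [interior_convexHull_nonempty_iff_affineSpan_eq_top]
    rw [← AffineSubspace.coe_eq_univ_iff, affineSpan_insert_zero, hspan, Submodule.top_coe]
  set s := volume.real (convexHull ℝ (insert 0 W))
  set A : ℝ → ℝ := fun δ => volume.real {x | x ∈ K ∧ 1 - δ < ⟪u, x⟫} with hA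
  obtain ⟨ε, hε0, hε1, hε⟩ : ∃ ε : ℝ, 0 < ε ∧ ε < 1 ∧ ∀ v ∈ V, ⟪u, v⟫ = 1 ∨ ⟪u, v⟫ ≤ 1 - ε := by
    have hev : ∀ᶠ ε in 𝓝[>] (0 : ℝ), ∀ v ∈ V, ⟪u, v⟫ = 1 ∨ ⟪u, v⟫ ≤ 1 - ε := by
      rw [Filter.eventually_all_finset]
      intro v hv
      rcases (hu v (hVK hv)).eq_or_lt with h | h
      · exact Filter.Eventually.of_forall fun _ => Or.inl h
      · filter_upwards [Ioo_mem_nhdsGT (sub_pos.2 h)] with ε hε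
        right
        linarith [hε.2]
    have h01 : ∀ᶠ ε in 𝓝[>] (0 : ℝ), ε ∈ Set.Ioo (0 : ℝ) 1 := Ioo_mem_nhdsGT zero_lt_one
    obtain ⟨ε, h1, h2⟩ := (h01.and hev).exists
    exact ⟨ε, h1.1, h1.2, h2⟩
  set c : ℕ := (V.filter fun v => ⟪u, v⟫ = 1).card
  have hfinA : ∀ δ : ℝ, volume {x | x ∈ K ∧ 1 - δ < ⟪u, x⟫} ≠ ∞ := fun δ =>
    ((measure_mono fun x hx => hx.1).trans_lt hK.measure_lt_top).ne
  have hstep : ∀ δ, δ ≤ ε → A (δ / 2) ≤ ((c : ℝ) / 2 ^ n) * A δ := by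
    intro δ hδ
    have h := two_pow_mul_volume_cap_le htile hu (ε := δ)
      fun v hv => (hε v hv).imp_right fun h => by linarith
    have h' := ENNReal.toReal_mono (ENNReal.mul_ne_top (ENNReal.natCast_ne_top _) (hfinA δ)) h
    rw [ENNReal.toReal_mul, ENNReal.toReal_mul, ENNReal.toReal_pow, ENNReal.toReal_natCast] at h'
    rw [div_mul_eq_mul_div, le_div_iff₀ (by positivity), mul_comm]
    exact h'
  have hiter : ∀ j : ℕ, A (ε / 2 ^ j) ≤ ((c : ℝ) / 2 ^ n) ^ j * A ε := by
    intro j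
    induction j with
    | zero => simp
    | succ j ih =>
      have hc : 0 ≤ (c : ℝ) / 2 ^ n := by positivity
      calc A (ε / 2 ^ (j + 1)) = A (ε / 2 ^ j / 2) := by rw [pow_succ, div_div]
        _ ≤ ((c : ℝ) / 2 ^ n) * A (ε / 2 ^ j) :=
          hstep _ (div_le_self hε0.le (one_le_pow₀ one_le_two))
        _ ≤ ((c : ℝ) / 2 ^ n) * (((c : ℝ) / 2 ^ n) ^ j * A ε) := mul_le_mul_of_nonneg_left ih hc
        _ = _ := by ring
  by_contra! hlt
  have hq : 2 * ((c : ℝ) / 2 ^ n) < 1 := by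
    rw [← mul_div_assoc, div_lt_one (by positivity)]
    exact_mod_cast hlt
  have hlow : ∀ j : ℕ, ε * s ≤ (2 * ((c : ℝ) / 2 ^ n)) ^ j * A ε := by
    intro j
    have hj : (0 : ℝ) < 2 ^ j := by positivity
    have h1 := mul_volume_le_volume_cap hn hK hKc h0 (u := u) (W := W) (fun v hv => hVK hv.1) hWne
      (fun v hv => hv.2) (δ := ε / 2 ^ j) (by positivity)
      ((div_le_self hε0.le (one_le_pow₀ one_le_two)).trans_lt hε1)
    have h2 := h1.trans (hiter j)
    rw [div_mul_eq_mul_div, div_le_iff₀ hj] at h2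
    calc ε * s ≤ ((c : ℝ) / 2 ^ n) ^ j * A ε * 2 ^ j := h2
      _ = _ := by rw [mul_pow]; ring
  have hlim : Filter.Tendsto (fun j : ℕ => (2 * ((c : ℝ) / 2 ^ n)) ^ j * A ε) Filter.atTop
      (𝓝 (0 * A ε)) :=
    (tendsto_pow_atTop_nhds_zero_of_lt_one (by positivity) hq).mul_const _
  have := ge_of_tendsto' hlim hlow
  rw [zero_mul] at this
  exact absurd (mul_pos hε0 hs) (not_lt.2 this)

end Facets

/-! ### Extreme points of the polar body, and the cube coordinates -/

section Polar

open scoped RealInnerProductSpace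

variable {n : ℕ} {K : Set (EuclideanSpace ℝ (Fin n))} {V : Finset (EuclideanSpace ℝ (Fin n))}
  {u : EuclideanSpace ℝ (Fin n)}

/-- The polar body of `K`. -/
def polarBody (K : Set (EuclideanSpace ℝ (Fin n))) : Set (EuclideanSpace ℝ (Fin n)) :=
  {u | ∀ x ∈ K, ⟪u, x⟫ ≤ 1}

theorem convex_halfSpace_inner (u : EuclideanSpace ℝ (Fin n)) (c : ℝ) :
    Convex ℝ {x : EuclideanSpace ℝ (Fin n) | ⟪u, x⟫ ≤ c} :=
  convex_halfSpace_le (innerSL ℝ u).isBoundedLinearMap.toIsLinearMap c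

theorem mem_polarBody_iff (hKV : K = convexHull ℝ (V : Set (EuclideanSpace ℝ (Fin n)))) :
    u ∈ polarBody K ↔ ∀ v ∈ V, ⟪u, v⟫ ≤ 1 := by
  refine ⟨fun h v hv => h v (hKV ▸ subset_convexHull ℝ _ hv), fun h x hx => ?_⟩
  rw [hKV] at hx
  exact convexHull_min (fun v hv => h v hv) (convex_halfSpace_inner u 1) hx

theorem convex_polarBody (K : Set (EuclideanSpace ℝ (Fin n))) : Convex ℝ (polarBody K) := by
  intro u hu w hw a b ha hb hab x hx
  rw [inner_add_left, real_inner_smul_left, real_inner_smul_left]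
  nlinarith [hu x hx, hw x hx]

theorem isCompact_polarBody (h0 : 0 ∈ interior K) : IsCompact (polarBody K) := by
  refine Metric.isCompact_of_isClosed_isBounded ?_ ?_
  · have : polarBody K = ⋂ x ∈ K, {u : EuclideanSpace ℝ (Fin n) | ⟪u, x⟫ ≤ 1} := by
      ext u
      simp [polarBody]
    rw [this]
    exact isClosed_biInter fun x _ => isClosed_le (by fun_prop) continuous_const
  · obtain ⟨ρ, hρ, hball⟩ := Metric.nhds_basis_closedBall.mem_iff.1
      (mem_interior_iff_mem_nhds.1 h0)
    refine isBounded_iff_forall_norm_le.2 ⟨ρ⁻¹, fun u hu => ?_⟩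
    rcases eq_or_ne u 0 with rfl | hu0
    · simpa using hρ.le
    have hnorm := norm_pos_iff.2 hu0
    have hmem : (ρ / ‖u‖) • u ∈ K := hball (by
      rw [mem_closedBall_zero_iff, norm_smul, Real.norm_of_nonneg (by positivity),
        div_mul_cancel₀ _ hnorm.ne'])
    have := hu _ hmem
    rw [real_inner_smul_right, real_inner_self_eq_norm_sq] at this
    rw [← one_div, le_div_iff₀ hρ]
    calc ‖u‖ * ρ = ρ / ‖u‖ * ‖u‖ ^ 2 := by field_simp
      _ ≤ 1 := this

theorem interior_polarBody_nonempty (hK : IsCompact K) : (interior (polarBody K)).Nonempty := by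
  obtain ⟨R, hR⟩ := isBounded_iff_forall_norm_le.1 hK.isBounded
  have hpos : 0 < (|R| + 1)⁻¹ := by positivity
  refine ⟨0, mem_interior_iff_mem_nhds.2
    (Filter.mem_of_superset (Metric.ball_mem_nhds 0 hpos) fun u hu x hx => ?_)⟩
  rw [mem_ball_zero_iff] at hu
  calc ⟪u, x⟫ ≤ ‖u‖ * ‖x‖ := real_inner_le_norm u x
    _ ≤ (|R| + 1)⁻¹ * (|R| + 1) := by
      refine mul_le_mul hu.le ?_ (norm_nonneg _) hpos.le
      linarith [hR x hx, le_abs_self R]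
    _ = 1 := inv_mul_cancel₀ (by positivity)

theorem span_extremePoints_polarBody (hK : IsCompact K) (h0 : 0 ∈ interior K) :
    Submodule.span ℝ (Set.extremePoints ℝ (polarBody K)) = ⊤ := by
  refine Submodule.eq_top_of_nonempty_interior' _
    ((interior_polarBody_nonempty hK).mono (interior_mono ?_))
  refine (closure_convexHull_extremePoints (isCompact_polarBody h0)
    (convex_polarBody K)).ge.trans ?_
  exact closure_minimal (convexHull_min Submodule.subset_span (Submodule.convex _))
    (Submodule.closed_of_finiteDimensional _)

/-- A vector `g ≠ 0` orthogonal to all active vertices would keep `u ± ε g` in the polar body for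
small `ε`, against extremality. -/
theorem span_active_eq_top (hKV : K = convexHull ℝ (V : Set (EuclideanSpace ℝ (Fin n))))
    (hu : u ∈ Set.extremePoints ℝ (polarBody K)) :
    Submodule.span ℝ {v | v ∈ V ∧ ⟪u, v⟫ = 1} = ⊤ := by
  rw [← Submodule.orthogonal_eq_bot_iff]
  by_contra hne
  obtain ⟨g, hg, hg0⟩ := Submodule.exists_mem_ne_zero_of_ne_bot hne
  have huV := (mem_polarBody_iff hKV).1 hu.1
  have hev : ∀ᶠ ε in 𝓝[>] (0 : ℝ), ∀ v ∈ V, ⟪u + ε • g, v⟫ ≤ 1 ∧ ⟪u - ε • g, v⟫ ≤ 1 := by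
    rw [Filter.eventually_all_finset]
    intro v hv
    rcases (huV v hv).eq_or_lt with h | h
    · have hgv : ⟪g, v⟫ = 0 := by
        rw [real_inner_comm]
        exact hg v (Submodule.subset_span ⟨hv, h⟩)
      refine Filter.Eventually.of_forall fun ε => ?_
      simp [inner_add_left, inner_sub_left, real_inner_smul_left, hgv, h]
    · refine nhdsWithin_le_nhds ?_
      have h1 : Continuous fun ε : ℝ => ⟪u + ε • g, v⟫ := by fun_prop
      have h2 : Continuous fun ε : ℝ => ⟪u - ε • g, v⟫ := by fun_prop
      have h1' := (h1.tendsto 0).eventually_lt_const (u := 1) (by simpa using h)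
      have h2' := (h2.tendsto 0).eventually_lt_const (u := 1) (by simpa using h)
      exact (h1'.and h2').mono fun ε hε => ⟨hε.1.le, hε.2.le⟩
  obtain ⟨ε, hε, hε0⟩ := (hev.and self_mem_nhdsWithin).exists
  have h := hu.2 ((mem_polarBody_iff hKV).2 fun v hv => (hε v hv).1)
    ((mem_polarBody_iff hKV).2 fun v hv => (hε v hv).2)
    ⟨1 / 2, 1 / 2, by norm_num, by norm_num, by norm_num, by module⟩
  rw [add_eq_left, smul_eq_zero] at h
  exact h.elim (ne_of_gt hε0) hg0

theorem neg_mem_extremePoints (hsymm : K = -K) {v : EuclideanSpace ℝ (Fin n)}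
    (hv : v ∈ Set.extremePoints ℝ K) : -v ∈ Set.extremePoints ℝ K := by
  have h : -v ∈ LinearEquiv.neg ℝ '' Set.extremePoints ℝ K := ⟨v, hv, rfl⟩
  rw [image_extremePoints] at h
  have himage : LinearEquiv.neg ℝ '' K = K := Set.image_neg_eq_neg.trans hsymm.symm
  rwa [himage] at h

/-- Negation carries the vertices at level 1 to level -1. Each level holds at least half of the
vertices, so together they exhaust `V`. -/
theorem inner_vertex_eq (hn : 1 ≤ n) (hK : IsCompact K) (hKc : Convex ℝ K)
    (h0 : 0 ∈ interior K) (hsymm : K = -K)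
    (hVext : (V : Set (EuclideanSpace ℝ (Fin n))) = Set.extremePoints ℝ K)
    (hKV : K = convexHull ℝ (V : Set (EuclideanSpace ℝ (Fin n)))) (hcard : V.card = 2 ^ n)
    (hV : ∀ v ∈ V, ∀ w ∈ V, v ≠ w → (1 / 2 : ℝ) • (v - w) ∉ interior K)
    (hu : u ∈ Set.extremePoints ℝ (polarBody K)) {v : EuclideanSpace ℝ (Fin n)} (hv : v ∈ V) :
    ⟪u, v⟫ = 1 ∨ ⟪u, v⟫ = -1 := by
  classical
  have hVK : (V : Set (EuclideanSpace ℝ (Fin n))) ⊆ K := hVext ▸ extremePoints_subset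
  have htile := volume_two_smul_diff_eq_zero hK hKc hsymm hVK hcard hV
  have hact := two_pow_le_two_mul_card_active hn hK hKc (interior_subset h0) hVK htile hu.1
    (span_active_eq_top hKV hu)
  have hVneg : ∀ w ∈ V, -w ∈ V := fun w hw => by
    rw [← Finset.mem_coe, hVext] at hw ⊢
    exact neg_mem_extremePoints hsymm hw
  set P := V.filter fun v => ⟪u, v⟫ = 1
  set Q := V.filter fun v => ⟪u, v⟫ = -1
  have hPQ : P.card ≤ Q.card := by
    refine Finset.card_le_card_of_injOn (fun w => -w) (fun w hw => ?_) neg_injective.injOn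
    obtain ⟨h1, h2⟩ := Finset.mem_filter.1 (Finset.mem_coe.1 hw)
    exact Finset.mem_coe.2 (Finset.mem_filter.2 ⟨hVneg w h1, by rw [inner_neg_right, h2]⟩)
  have hdisj : Disjoint P Q := by
    rw [Finset.disjoint_filter]
    intro w _ h1 h2
    linarith
  have hunion : P ∪ Q = V := by
    refine Finset.eq_of_subset_of_card_le
      (Finset.union_subset (Finset.filter_subset _ _) (Finset.filter_subset _ _)) ?_
    rw [Finset.card_union_of_disjoint hdisj, hcard]
    omega
  rw [← hunion, Finset.mem_union] at hv
  rcases hv with h | h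
  · exact Or.inl (Finset.mem_filter.1 h).2
  · exact Or.inr (Finset.mem_filter.1 h).2

/-- A polytope with `2 ^ n` vertices on which `n` linearly independent functionals only take the
values `1` and `-1` is a parallelotope. -/
theorem isParallelotope_of_inner_eq
    (hKV : K = convexHull ℝ (V : Set (EuclideanSpace ℝ (Fin n)))) (hcard : V.card = 2 ^ n)
    {u : Fin n → EuclideanSpace ℝ (Fin n)} (hu : LinearIndependent ℝ u)
    (huV : ∀ j, ∀ v ∈ V, ⟪u j, v⟫ = 1 ∨ ⟪u j, v⟫ = -1) : IsParallelotope K := by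
  classical
  let Φ : EuclideanSpace ℝ (Fin n) →ₗ[ℝ] (Fin n → ℝ) :=
    LinearMap.pi fun j => (1 / 2 : ℝ) • (innerSL ℝ (u j)).toLinearMap
  have hΦ : ∀ x j, Φ x j = 1 / 2 * ⟪u j, x⟫ := fun x j => rfl
  have hspan : Submodule.span ℝ (Set.range u) = ⊤ :=
    hu.span_eq_top_of_card_eq_finrank' (by simp)
  have hinj : Function.Injective Φ := by
    rw [← LinearMap.ker_eq_bot, LinearMap.ker_eq_bot']
    intro x hx
    have hmem : x ∈ (Submodule.span ℝ (Set.range u))ᗮ := by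
      rw [Submodule.mem_orthogonal]
      intro y hy
      induction hy using Submodule.span_induction with
      | mem y hy =>
        obtain ⟨j, rfl⟩ := hy
        have := congrFun hx j
        rw [hΦ, Pi.zero_apply] at this
        linarith
      | zero => simp
      | add y z _ _ hy hz => rw [inner_add_left, hy, hz, add_zero]
      | smul a y _ hy => rw [real_inner_smul_left, hy, mul_zero]
    rwa [hspan, Submodule.top_orthogonal_eq_bot, Submodule.mem_bot] at hmem
  let e : EuclideanSpace ℝ (Fin n) ≃ₗ[ℝ] (Fin n → ℝ) :=
    LinearEquiv.ofInjectiveOfFinrankEq Φ hinj (by simp)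
  have he : ∀ x, e x = Φ x := fun x => rfl
  let b : Module.Basis (Fin n) ℝ (EuclideanSpace ℝ (Fin n)) := Module.Basis.ofEquivFun e
  have hb : ∀ x j, b.repr x j = 1 / 2 * ⟪u j, x⟫ := fun x j => by
    rw [← hΦ, ← he]
    rfl
  -- In the coordinates `⟪u j, x⟫ / 2` the vertices have entries `±1/2`; measured from `c` they have
  -- entries 0 or 1. Equal cardinalities make `V` the full vertex set of the cube.
  let c : EuclideanSpace ℝ (Fin n) := e.symm fun _ => -1 / 2
  have hc : ∀ j, b.repr c j = -1 / 2 := fun j => by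
    rw [hb, ← hΦ, ← he, LinearEquiv.apply_symm_apply]
  have hsub : V ⊆ Finset.univ.image fun S : Finset (Fin n) => c + ∑ j ∈ S, b j := by
    intro v hv
    refine Finset.mem_image.2 ⟨Finset.univ.filter fun j => ⟪u j, v⟫ = 1, Finset.mem_univ _, ?_⟩
    rw [← sub_left_inj (a := c)]
    refine b.ext_elem fun j => ?_
    rw [repr_vertex, map_sub, Finsupp.sub_apply, hb, hc]
    rcases huV j v hv with h | h
    · rw [if_pos (by simpa using h), h]
      norm_num
    · rw [if_neg (by simp [h]; norm_num), h]
      norm_num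
  have hVeq : V = Finset.univ.image fun S : Finset (Fin n) => c + ∑ j ∈ S, b j := by
    refine Finset.eq_of_subset_of_card_le hsub (Finset.card_image_le.trans ?_)
    simp [hcard]
  refine ⟨b, c, Set.Subset.antisymm ?_ ?_⟩
  · have hconv : Convex ℝ (c +ᵥ parallelepiped b) := by
      rw [parallelepiped_eq_convexHull]
      exact (convex_convexHull ℝ _).vadd c
    rw [hKV]
    refine convexHull_min (fun v hv => ?_) hconv
    obtain ⟨S, -, rfl⟩ := Finset.mem_image.1 (hsub hv)
    exact vertex_mem S
  · rw [parallelepiped_eq_convexHull, ← convexHull_vadd, hKV]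
    refine convexHull_mono ?_
    rintro _ ⟨x, hx, rfl⟩
    obtain ⟨g, hg, rfl⟩ := Set.mem_fintype_sum _ _ |>.1 hx
    rw [Finset.mem_coe, hVeq]
    refine Finset.mem_image.2 ⟨Finset.univ.filter fun j => g j ≠ 0, Finset.mem_univ _, ?_⟩
    simp only [vadd_eq_add]
    rw [Finset.sum_filter]
    congr 1
    refine Finset.sum_congr rfl fun j _ => ?_
    rcases hg j with h | h
    · rw [if_neg (by simp [h]), h]
    · rw [Set.mem_singleton_iff] at h
      rw [if_pos (by rw [h]; exact b.ne_zero j), h]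

theorem isParallelotope_of_two_pow_le_weightedCoveringNumber (hn : 1 ≤ n) (hK : IsCompact K)
    (hKc : Convex ℝ K) (h0 : 0 ∈ interior K) (hsymm : K = -K)
    (hle : ∀ r ∈ Set.Ioo (0 : ℝ) 1, 2 ^ n ≤ weightedCoveringNumber K (r • K)) :
    IsParallelotope K := by
  obtain ⟨Λ, hΛ1, hΛ⟩ := exists_dual_functional hK hKc h0 (M := 2 ^ n)
    (fun r hr => by simpa using hle r hr)
  obtain ⟨V, hVext, hKV, hcard, hV⟩ := exists_finset_extremePoints (Λ := Λ) hΛ hK hKc h0 hsymm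
    (by simpa using hΛ1)
  have hspan := span_extremePoints_polarBody hK h0
  obtain ⟨f, hf, -, hli⟩ := Submodule.exists_fun_fin_finrank_span_eq ℝ
    (Set.extremePoints ℝ (polarBody K))
  have hrank : Module.finrank ℝ (Submodule.span ℝ (Set.extremePoints ℝ (polarBody K))) = n := by
    rw [hspan, finrank_top, finrank_euclideanSpace_fin]
  exact isParallelotope_of_inner_eq hKV hcard (u := f ∘ Fin.cast hrank.symm)
    (hli.comp _ (Fin.cast_injective _))
    fun j v hv => inner_vertex_eq hn hK hKc h0 hsymm hVext hKV hcard hV (hf _) hv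

end Polar

theorem theorem1p12 (n : ℕ) (hn : 1 ≤ n) (K : Set (EuclideanSpace ℝ (Fin n)))
    (hK_compact : IsCompact K) (hK_convex : Convex ℝ K) (hK_int : (interior K).Nonempty) :
    (∃ L : ℝ≥0∞,
      Filter.Tendsto (fun r : ℝ => weightedCoveringNumber K (r • K)) (𝓝[<] 1) (𝓝 L) ∧
      (K = -K → L ≤ 2 ^ n) ∧
      (K ≠ -K → L ≤ ((2 * n).choose n : ℝ≥0∞)) ∧
      (K = -K → (L = 2 ^ n ↔ IsParallelotope K))) ∧
    (K = -K →
      fractionalIlluminationNumber K ≤ 2 ^ n ∧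
      (fractionalIlluminationNumber K = 2 ^ n ↔ IsParallelotope K)) := by
  set L := ⨅ r ∈ Set.Ioo (0 : ℝ) 1, weightedCoveringNumber K (r • K) with hL
  have hLvol : L ≤ volume (K - K) / volume K :=
    iInf_weightedCoveringNumber_smul_le hK_compact hK_convex hK_int
  have hsymmL : K = -K → L ≤ 2 ^ n := by
    intro hsymm
    refine hLvol.trans (ENNReal.div_le_of_le_mul ?_)
    rw [← volume_two_smul]
    refine measure_mono ?_
    rintro _ ⟨a, ha, b, hb, rfl⟩
    have hb' : -b ∈ K := by rw [hsymm]; simpa using hb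
    simpa [sub_eq_add_neg] using add_mem_two_smul hK_convex ha hb'
  have h0 : K = -K → 0 ∈ interior K := by
    intro hsymm
    obtain ⟨x, hx⟩ := hK_int
    have hx' : -x ∈ interior K := by
      rw [hsymm]
      have : x ∈ (Homeomorph.neg (EuclideanSpace ℝ (Fin n))) ⁻¹' interior (-K) := by
        rw [(Homeomorph.neg _).preimage_interior]
        simpa using hx
      exact this
    have := hK_convex.interior hx hx' (show (0 : ℝ) ≤ 1 / 2 by norm_num)
      (show (0 : ℝ) ≤ 1 / 2 by norm_num) (by norm_num)
    simpa using this
  have hpar : K = -K → 2 ^ n ≤ L → IsParallelotope K := fun hsymm hle =>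
    isParallelotope_of_two_pow_le_weightedCoveringNumber hn hK_compact hK_convex (h0 hsymm) hsymm
      fun r hr => hle.trans (iInf₂_le r hr)
  -- With `i*(K) ≤ L ≤ 2^n`, the equality `i*(K) = 2^n` forces `L = 2^n`, so both equality cases
  -- rest on `hpar`.
  have hillum : K = -K → fractionalIlluminationNumber K ≤ L := fun hsymm =>
    le_iInf₂ fun r hr => fractionalIlluminationNumber_le_weightedCoveringNumber hn hK_compact
      hK_convex (h0 hsymm) hr.1 hr.2
  refine ⟨⟨L, tendsto_weightedCoveringNumber_smul hK_convex (hK_int.mono interior_subset), hsymmL,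
    fun _ => hLvol.trans (volume_sub_self_div_le hn hK_compact hK_convex hK_int),
    fun hsymm => ⟨fun h => hpar hsymm h.ge, fun h => (hsymmL hsymm).antisymm
      (le_iInf₂ fun r hr => two_pow_le_weightedCoveringNumber_parallelotope h hr)⟩⟩,
    fun hsymm => ⟨(hillum hsymm).trans (hsymmL hsymm), fun h => hpar hsymm (h ▸ hillum hsymm),
      fun h => ((hillum hsymm).trans (hsymmL hsymm)).antisymm
        (two_pow_le_fractionalIlluminationNumber_parallelotope hn h)⟩⟩
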